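/- **Setting.** Let $1\le n_w<n_s$, $L\ge 1$ be integers, $p\ge 1$, $c\ge 0$, $K>0$ real. Let $\Theta=\mathbb R^{n_s}\times\mathbb S^{n_s}$, with $\mathbb S^{n_s}$ the set of covariance matrices, and write $\theta=(\mu,\Sigma)$. For each $\theta\in\Theta$ let $\kappa(\theta)$ be a law on $\mathbb R^{n_s}$, measurable in $\theta$, with moments of all orders, mean $\mu$ and covariance $\Sigma$. The parameter $\tilde\theta=(\tilde\mu,\tilde\Sigma)$ is random and, given $\tilde\theta$, the simulations $P_j=(P_j^1,\dots,P_j^{n_s})$, $j\ge1$, are i.i.d. with law $\kappa(\tilde\theta)$. Let $\mathcal M$ be a set of probability measures on $\Theta$. *Controls.* A control is a process $\alpha=(q_\ell,N_\ell)_{0\le\ell\le L}$, a function of the simulations, with integer values, $q$ non-increasing with values in $[n_w,n_s]$, $q_0=n_s$, $q_{L-1}=n_w$, $N$ non-decreasing, $N_0=0$. Put $\hat\mu^i_\ell=\frac1{N_\ell}\sum_{j\le N_\ell}P^i_j$; $\mathfrak I_0=\{1,\dots,n_s\}$; and for $\ell\ge1$ let $\mathfrak I_\ell$ be the set of the first $q_\ell$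 elements of $\mathfrak I_{\ell-1}$ ranked by decreasing $\hat\mu_\ell$, ties being broken in favour of the smaller index. Let $\mathcal F^\alpha_0$ be trivial and $\mathcal F^\alpha_\ell=\mathcal F^\alpha_{\ell-1}\vee\sigma(P^i_j:\ i\in\mathfrak I_{\ell-1},\ j\le N_\ell)$. The set $\mathcal A^{\rm ad}$ consists of the controls such that $(q_\ell,N_\ell)$ is $\mathcal F^\alpha_{\ell-1}$-measurable for $1\le\ell\le L$, and $\mathcal A^{\rm ad}(\ell,\alpha)$ of the $\alpha'\in\mathcal A^{\rm ad}$ that coincide with $\alpha$ at levels $0,\dots,\ell$ and satisfy $\sum_{l=0}^{L-1}q'_l(N'_{l+1}-N'_l)\le K$. *Costs* (with $x/0=0$, $\max\emptyset=0$, $\delta q_\ell=q_{\ell-1}-q_\ell$, $\delta N_\ell=N_\ell-N_{\ell-1}$, $\tilde\sigma_{ik}^2=\tilde\Sigma^{ii}+\tilde\Sigma^{kk}-2\tilde\Sigma^{ik}$). For $\ell\ge1$, with $\rho_\ell[i,k]=\tilde\mu^i-\tilde\mu^k+\frac{N_{\ell-1}}{\delta N_\ell}(\hat\mu^i_{\ell-1}-\hat\mu^k_{\ell-1})$,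 let $$f^{\rm ad}_p(\ell,\alpha,\tilde\theta)=\delta q_\ell\max_{(i,k)}(\tilde\mu^i-\tilde\mu^k)^p\Big(e^{-\frac{\delta N_\ell\,\rho_\ell[i,k]^2}{2(\tilde\sigma_{ik}^2+c\rho_\ell[i,k])}}\mathbf 1_{\{\rho_\ell[i,k]\ge0\}}+\mathbf 1_{\{\rho_\ell[i,k]<0\}}\Big),$$ the maximum being over $i,k\in\mathfrak I_{\ell-1}$ whose ranks in $\mathfrak I_{\ell-1}$, by decreasing $\tilde\mu$ with the same tie-break, lie in $[1,n_w]$ and in $[q_\ell+1,q_{\ell-1}]$ respectively. *Current laws.* Let $\nu$ be an $\mathcal F^\alpha_\ell$-measurable random measure with values in $\mathcal M$ (for instance a fixed $\nu\in\mathcal M$), viewed as the law of $\tilde\theta$ given $\mathcal F^\alpha_\ell$. Then $\mathbb E^\nu[\,\cdot\,|\mathcal F^\alpha_\ell]$ is the conditional expectation when, given $\mathcal F^\alpha_\ell$, $\tilde\theta$ has law $\nu$ and, given also $\tilde\theta$, the simulations $P_j$, $j>N_\ell$, are i.i.d. with law $\kappa(\tilde\theta)$. For an arbitrary law $\lambda$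 of the simulations made before, $\mathbb P^\nu$ is the resulting joint law of $\tilde\theta$ and the simulations (for $\ell=0$: $\tilde\theta\sim\nu$). Almost sure statements and essential infima refer to $\mathbb P^\nu$. Define, in $[0,\infty]$, $${\rm F}^{\rm ad}_p(\ell,\alpha',\nu)=\mathbb E^\nu\Big[\Big|\frac1{n_w}\sum_{i\in\mathfrak I^{\alpha'}_{L-1}}(\hat\mu_L^{\alpha',i}-\tilde\mu^i)\Big|^p+\sum_{l=\ell+1}^{L-1}f^{\rm ad}_p(l,\alpha',\tilde\theta)\,\Big|\,\mathcal F^{\alpha'}_\ell\Big],\qquad \hat{\rm F}^{\rm ad}_p(\ell,\alpha,\nu)=\operatorname*{ess\,inf}_{\alpha'\in\mathcal A^{\rm ad}(\ell,\alpha)}{\rm F}^{\rm ad}_p(\ell,\alpha',\nu).$$ *Assumption (under $\mathbb P^\nu$, from step $\ell$ on).* There are a measure $m$ and a nonnegative measurable bounded map $g$, continuous in its first argument uniformly in $\theta$, such that for all $\alpha'\in\mathcal A^{\rm ad}$ coinciding with $\alpha$ up to level $\ell$ and all $\ell<l\le L$, the law of $I^{\alpha'}_l=(P^i_j:\ i\in\mathfrak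 I^{\alpha'}_{l-1},\ N'_{l-1}<j\le N'_l)$ given $\mathcal F^{\alpha'}_{l-1}\vee\sigma(\tilde\theta)$ has a.s. the density $g(\cdot,\mathfrak I^{\alpha'}_{l-1},N'_{l-1},N'_l,\tilde\theta|_{\mathfrak I^{\alpha'}_{l-1}})$ with respect to $m$, where $\theta|_A=((\mu^i)_{i\in A},(\Sigma^{ik})_{i,k\in A})$; and for all these $\alpha'$ and all $\ell\le l\le L$ the law of $\tilde\theta$ given $\mathcal F^{\alpha'}_l$ belongs a.s. to $\mathcal M$. *Bayesian update.* $$\mathcal U(\ell+1,\alpha',\nu)(d\theta)=\frac{g(I^{\alpha'}_{\ell+1},\mathfrak I^{\alpha'}_\ell,N'_\ell,N'_{\ell+1},\theta|_{\mathfrak I^{\alpha'}_\ell})\,\nu(d\theta)}{\int_\Theta g(I^{\alpha'}_{\ell+1},\mathfrak I^{\alpha'}_\ell,N'_\ell,N'_{\ell+1},\vartheta|_{\mathfrak I^{\alpha'}_\ell})\,\nu(d\vartheta)}.$$ **Proposition 4.** Let $\alpha\in\mathcal A^{\rm ad}$, $0\le\ell\le L-2$, let $\nu$ be an $\mathcal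 F^\alpha_\ell$-measurable $\mathcal M$-valued random measure (in particular any fixed $\nu\in\mathcal M$), and let the Assumption hold. Then $\mathcal U(\ell+1,\alpha',\nu)\in\mathcal M$ a.s. for every $\alpha'\in\mathcal A^{\rm ad}(\ell,\alpha)$, and almost surely $$\hat{\rm F}^{\rm ad}_p(\ell,\alpha,\nu)=\operatorname*{ess\,inf}_{\alpha'\in\mathcal A^{\rm ad}(\ell,\alpha)}\mathbb E^\nu\big[\hat{\rm F}^{\rm ad}_p(\ell+1,\alpha',\mathcal U(\ell+1,\alpha',\nu))+f^{\rm ad}_p(\ell+1,\alpha',\tilde\theta)\,\big|\,\mathcal F^\alpha_\ell\big].$$ -/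

import Mathlib

open MeasureTheory ProbabilityTheory
open scoped ENNReal NNReal

noncomputable section

namespace AdaptiveES

/-- A parameter `θ = (μ, Σ)` on an index set `ι`: a vector of means and a covariance matrix. -/
abbrev Param (ι : Type) : Type :=
  (ι → ℝ) × {S : ι → ι → ℝ // (Matrix.of S).PosSemidef}

/-- Restriction of `θ = (μ, Σ)` to the components whose indices lie in `A`. -/
def Param.restrict {n : ℕ} (A : Finset (Fin n)) (θ : Param (Fin n)) : Param A :=
  (fun i => θ.1 i, ⟨fun i k => θ.2.1 i k, θ.2.2.submatrix (fun i : A => (i : Fin n))⟩)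

/-- A realisation of all simulations: `x j i` is the `(j+1)`-th simulated price in scenario `i`. -/
abbrev Path (n : ℕ) : Type := ℕ → Fin n → ℝ

/-- The fixed data: number of scenarios, of worst scenarios, of levels, the exponent `p`, the
sub-gamma constant `c` and the total effort `K`. -/
structure Setup where
  ns : ℕ
  nw : ℕ
  L : ℕ
  p : ℝ
  c : ℝ
  K : ℝ
  one_le_nw : 1 ≤ nw
  nw_lt_ns : nw < ns
  one_le_L : 1 ≤ L
  one_le_p : 1 ≤ p
  c_nonneg : 0 ≤ c
  K_pos : 0 < K

/-- The law of the vector of scenario prices given the parameter: it has moments of all orders,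
and the parameter is its mean vector and its covariance matrix. -/
structure Market (n : ℕ) where
  law : Kernel (Param (Fin n)) (Fin n → ℝ)
  isMarkov : IsMarkovKernel law
  memLp : ∀ θ i (r : ℝ≥0), 1 ≤ r → MemLp (fun z : Fin n → ℝ => z i) r (law θ)
  mean_eq : ∀ θ i, ∫ z, z i ∂(law θ) = θ.1 i
  cov_eq : ∀ θ i k, cov[fun z : Fin n → ℝ => z i, fun z => z k; law θ] = θ.2.1 i k

theorem measurable_iid {n : ℕ} (mkt : Market n) :
    Measurable fun θ => Measure.infinitePi fun _ : ℕ => mkt.law θ := by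
  have := mkt.isMarkov
  refine Measurable.measure_of_isPiSystem_of_isProbabilityMeasure
    generateFrom_squareCylinders.symm
    (isPiSystem_squareCylinders (fun _ => MeasurableSpace.isPiSystem_measurableSet) (by simp)) ?_
  rintro _ ⟨s, t, ht, rfl⟩
  have ht' : ∀ i, MeasurableSet (t i) := fun i => ht i (Set.mem_univ i)
  have h : ∀ θ, Measure.infinitePi (fun _ : ℕ => mkt.law θ) ((s : Set ℕ).pi t)
      = ∏ i ∈ s, mkt.law θ (t i) := fun θ => Measure.infinitePi_pi _ fun i _ => ht' i
  simp_rw [h]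
  exact Finset.measurable_prod _ fun i _ => Kernel.measurable_coe _ (ht' i)

/-- Given `θ`, the simulations are independent copies of the price vector. -/
def Market.iid {n : ℕ} (mkt : Market n) : Kernel (Param (Fin n)) (Path n) :=
  ⟨fun θ => Measure.infinitePi fun _ : ℕ => mkt.law θ, measurable_iid mkt⟩

/-! ### Controls and the selection algorithm -/

/-- A process `α = (q, N)`; only the levels `0, …, L` matter. -/
structure Control (n : ℕ) where
  q : ℕ → Path n → ℕ
  N : ℕ → Path n → ℕ

/-- Monte Carlo mean of the first `N` simulations in scenario `i`. -/
def estimate {n : ℕ} (N : ℕ) (x : Path n) (i : Fin n) : ℝ :=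
  (∑ j ∈ Finset.range N, x j i) / N

/-- Number of elements of `A` that precede `i` when `A` is ranked by decreasing `v`, ties being
broken in favour of the smaller index. The element of rank `r` in `A`, that is the image of `r`
under the ranking permutation, is the one with `position = r - 1`. -/
def position {n : ℕ} (A : Finset (Fin n)) (v : Fin n → ℝ) (i : Fin n) : ℕ :=
  (A.filter fun k => v i < v k ∨ (v k = v i ∧ k < i)).card

/-- The set of scenarios kept after step `l`: all at step `0`, then at step `l + 1` the
`q (l + 1)` first ones in the ranking of the estimates. -/
def Control.selected {n : ℕ} (α : Control n) : ℕ → Path n → Finset (Fin n)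
  | 0, _ => Finset.univ
  | l + 1, x => (α.selected l x).filter fun i =>
      position (α.selected l x) (estimate (α.N (l + 1) x) x) i < α.q (l + 1) x

/-- The information after each step. Step `l + 1` reveals the first `N (l + 1)` simulations in the
scenarios still under consideration when that step is run. -/
def Control.filtration {n : ℕ} (α : Control n) : ℕ → MeasurableSpace (Path n)
  | 0 => ⊥
  | l + 1 => α.filtration l ⊔ MeasurableSpace.comap
      (fun (x : Path n) (j : ℕ) (i : Fin n) =>
        if i ∈ α.selected l x ∧ j < α.N (l + 1) x then x j i else 0) inferInstance

/-- Admissible controls: `q` is non-increasing from `ns` to `nw = q (L - 1)`, `N` is non-decreasing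
from `0`, and both are predictable for the information that the control generates. -/
structure Setup.Admissible (S : Setup) (α : Control S.ns) : Prop where
  q_zero : ∀ x, α.q 0 x = S.ns
  q_last : ∀ x, α.q (S.L - 1) x = S.nw
  q_anti : ∀ l < S.L, ∀ x, α.q (l + 1) x ≤ α.q l x
  nw_le_q : ∀ l ≤ S.L, ∀ x, S.nw ≤ α.q l x
  N_zero : ∀ x, α.N 0 x = 0
  N_mono : ∀ l < S.L, ∀ x, α.N l x ≤ α.N (l + 1) x
  q_predictable : ∀ l < S.L, Measurable[α.filtration l] (α.q (l + 1))
  N_predictable : ∀ l < S.L, Measurable[α.filtration l] (α.N (l + 1))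

/-- The two controls coincide at the levels `0, …, l`. -/
def AgreeUpTo {n : ℕ} (l : ℕ) (α α' : Control n) : Prop :=
  ∀ k ≤ l, α'.q k = α.q k ∧ α'.N k = α.N k

/-- Total computational cost. -/
def Setup.totalCost (S : Setup) (α : Control S.ns) (x : Path S.ns) : ℝ :=
  ∑ l ∈ Finset.range S.L, (α.q l x : ℝ) * ((α.N (l + 1) x : ℝ) - α.N l x)

/-- Admissible continuations of `α` after step `l` that respect the budget. -/
def Setup.continuations (S : Setup) (l : ℕ) (α : Control S.ns) : Set (Control S.ns) :=
  {α' | S.Admissible α' ∧ AgreeUpTo l α α' ∧ ∀ x, S.totalCost α' x ≤ S.K}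

/-! ### Costs -/

/-- `ρ_l[i,k]`, for `l ≥ 1`. -/
def rho {n : ℕ} (α : Control n) (l : ℕ) (θ : Param (Fin n)) (x : Path n) (i k : Fin n) : ℝ :=
  θ.1 i - θ.1 k + (α.N (l - 1) x : ℝ) / ((α.N l x : ℝ) - α.N (l - 1) x) *
    (estimate (α.N (l - 1) x) x i - estimate (α.N (l - 1) x) x k)

/-- The variance of the difference of the prices in the scenarios `i` and `k`. -/
def sigmaSq {n : ℕ} (θ : Param (Fin n)) (i k : Fin n) : ℝ :=
  θ.2.1 i i + θ.2.1 k k - 2 * θ.2.1 i k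

/-- The selection cost `f_p(l, α, θ)` of step `l ≥ 1`. The pairs `(i, k)` are those of
scenarios kept before step `l` such that, in the ranking by the true means, `i` has rank in
`[1, nw]` and `k` has rank in `[q_l + 1, q_{l-1}]`; the maximum over no pair is `0`. -/
def Setup.stepCost (S : Setup) (α : Control S.ns) (l : ℕ) (ω : Param (Fin S.ns) × Path S.ns) :
    ℝ≥0∞ :=
  let θ := ω.1
  let x := ω.2
  let A := α.selected (l - 1) x
  ((α.q (l - 1) x - α.q l x : ℕ) : ℝ≥0∞) *
    ((A ×ˢ A).filter fun ik => position A θ.1 ik.1 < S.nw ∧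
        α.q l x ≤ position A θ.1 ik.2 ∧ position A θ.1 ik.2 < α.q (l - 1) x).sup
      fun ik =>
        let r := rho α l θ x ik.1 ik.2
        ENNReal.ofReal ((θ.1 ik.1 - θ.1 ik.2) ^ S.p *
          if 0 ≤ r then
            Real.exp (-((((α.N l x : ℝ) - α.N (l - 1) x) * r ^ 2) /
              (2 * (sigmaSq θ ik.1 ik.2 + S.c * r))))
          else 1)

/-- The `p`-th power of the final Monte Carlo error. -/
def Setup.finalCost (S : Setup) (α : Control S.ns) (ω : Param (Fin S.ns) × Path S.ns) : ℝ≥0∞ :=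
  ENNReal.ofReal (|1 / (S.nw : ℝ) * ∑ i ∈ α.selected (S.L - 1) ω.2,
    (estimate (α.N S.L ω.2) ω.2 i - ω.1.1 i)| ^ S.p)

/-- The cost that remains after step `l`. -/
def Setup.costToGo (S : Setup) (l : ℕ) (α : Control S.ns) (ω : Param (Fin S.ns) × Path S.ns) :
    ℝ≥0∞ :=
  S.finalCost α ω + ∑ k ∈ Finset.Icc (l + 1) (S.L - 1), S.stepCost α k ω

/-! ### Conditional expectations for a given current law of the parameter -/

/-- The path whose first `N` simulations are those of `x` and whose later ones are those of `y`. -/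
def splice {n : ℕ} (N : ℕ) (x y : Path n) : Path n := fun j => if j < N then x j else y j

/-- `𝔼^ν[Φ | F_l]`: the simulations used up to step `l` are frozen, the parameter has the current
(possibly random) law `ν`, and given the parameter the later simulations are fresh independent
copies of the price vector. -/
def condE {n : ℕ} (mkt : Market n) (l : ℕ) (α : Control n) (ν : Path n → Measure (Param (Fin n)))
    (Φ : Param (Fin n) × Path n → ℝ≥0∞) (x : Path n) : ℝ≥0∞ :=
  ∫⁻ θ, ∫⁻ y, Φ (θ, splice (α.N l x) x y) ∂(mkt.iid θ) ∂(ν x)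

/-- `ℙ^ν`, the joint law of the parameter and of the simulations for which `condE` is the
conditional expectation given `F_l`: the past up to step `l` is drawn from `past`, and the
law of the parameter given `F_l` is `ν`. For `l = 0` the choice of `past` is immaterial. -/
def stepLaw {n : ℕ} (mkt : Market n) (l : ℕ) (α : Control n)
    (ν : Kernel (Path n) (Param (Fin n))) (past : Measure (Path n)) :
    Measure (Param (Fin n) × Path n) :=
  ((past ⊗ₘ ν) ⊗ₘ (mkt.iid.comap Prod.snd measurable_snd)).map
    fun w => (w.1.2, splice (α.N l w.1.1) w.1.1 w.2)

/-! ### Essential infimum of a family of random variables -/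

/-- `V` is the essential infimum of the family `T`: the greatest (up to null sets) random
variable that lies almost surely below each member. -/
structure IsEssInfFamily {X : Type*} [MeasurableSpace X] (P : Measure X) (T : Set (X → ℝ≥0∞))
    (V : X → ℝ≥0∞) : Prop where
  measurable : Measurable V
  le : ∀ f ∈ T, V ≤ᵐ[P] f
  greatest : ∀ h : X → ℝ≥0∞, Measurable h → (∀ f ∈ T, h ≤ᵐ[P] f) → h ≤ᵐ[P] V

theorem exists_isEssInfFamily {X : Type*} [MeasurableSpace X] (P : Measure X) [IsFiniteMeasure P]
    (T : Set (X → ℝ≥0∞)) : ∃ V, IsEssInfFamily P T V := by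
  let H : Set (X → ℝ≥0∞) := {h | Measurable h ∧ ∀ f ∈ T, h ≤ᵐ[P] f}
  let I : (X → ℝ≥0∞) → ℝ≥0∞ := fun h => ∫⁻ x, (1 + h x)⁻¹ ∂P
  have h0 : (fun _ => 0 : X → ℝ≥0∞) ∈ H :=
    ⟨measurable_const, fun f _ => Filter.Eventually.of_forall fun x => zero_le⟩
  have hne : (I '' H).Nonempty := ⟨_, _, h0, rfl⟩
  obtain ⟨u, -, hu, huI⟩ := exists_seq_tendsto_sInf hne (OrderBot.bddBelow _)
  choose h hH hI using huI
  let V : X → ℝ≥0∞ := fun x => ⨆ k, h k x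
  have hVH : V ∈ H := by
    refine ⟨Measurable.iSup fun k => (hH k).1, fun f hf => ?_⟩
    have : ∀ᵐ x ∂P, ∀ k, h k x ≤ f x := ae_all_iff.2 fun k => (hH k).2 f hf
    filter_upwards [this] with x hx using iSup_le hx
  have hVI : I V ≤ sInf (I '' H) := by
    refine ge_of_tendsto' hu fun k => ?_
    rw [← hI k]
    refine lintegral_mono fun x => ENNReal.inv_le_inv.2 ?_
    gcongr
    exact le_iSup (fun k => h k x) k
  refine ⟨V, hVH.1, hVH.2, fun g hg hgT => ?_⟩
  let W : X → ℝ≥0∞ := fun x => g x ⊔ V x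
  have hWH : W ∈ H := by
    refine ⟨hg.sup hVH.1, fun f hf => ?_⟩
    filter_upwards [hgT f hf, hVH.2 f hf] with x h1 h2 using sup_le h1 h2
  have hle : I V ≤ I W := hVI.trans (sInf_le ⟨W, hWH, rfl⟩)
  have hfin : I W ≠ ∞ := by
    refine ne_top_of_le_ne_top (measure_ne_top P Set.univ) ?_
    calc I W ≤ ∫⁻ _, 1 ∂P := lintegral_mono fun x => by simp
      _ = P Set.univ := by simp
  have hae : (fun x => (1 + W x)⁻¹) =ᵐ[P] fun x => (1 + V x)⁻¹ := by
    refine ae_eq_of_ae_le_of_lintegral_le ?_ hfin ?_ hle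
    · refine Filter.Eventually.of_forall fun x => ENNReal.inv_le_inv.2 ?_
      gcongr
      exact le_sup_right
    · exact ((measurable_const.add hVH.1).inv).aemeasurable
  filter_upwards [hae] with x hx
  have h1 : 1 + W x = 1 + V x := inv_injective hx
  have h2 : W x = V x := (ENNReal.add_right_inj ENNReal.one_ne_top).1 h1
  exact le_sup_left.trans h2.le

open Classical in
/-- A version of the essential infimum of the family `T`; it exists whenever `P` is finite. -/
def essInfFamily {X : Type*} [MeasurableSpace X] (P : Measure X) (T : Set (X → ℝ≥0∞)) :
    X → ℝ≥0∞ :=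
  if h : ∃ V, IsEssInfFamily P T V then h.choose else 0

/-- The value function: the essential infimum, over the continuations `α'` of `α` after step `l`,
of the conditional expected cost to go when the current law of the parameter is `ν`. Null sets are
those of the law `P` of the simulations. -/
def Setup.value (S : Setup) (mkt : Market S.ns) (P : Measure (Path S.ns)) (l : ℕ)
    (α : Control S.ns) (ν : Path S.ns → Measure (Param (Fin S.ns))) : Path S.ns → ℝ≥0∞ :=
  essInfFamily P {F | ∃ α' ∈ S.continuations l α, F = condE mkt l α' ν (S.costToGo l α')}

/-! ### Conditional densities and the Bayesian update -/

/-- The simulations number `N + 1, …, N'` in the scenarios of `A`. -/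
def block {n : ℕ} (A : Finset (Fin n)) (N N' : ℕ) (x : Path n) : A × Finset.Ico N N' → ℝ :=
  fun ij => x ij.2 ij.1

/-- A measure on each of the spaces in which a block of simulations can take its values (that is, a
measure on their disjoint union). -/
abbrev BaseMeasure (n : ℕ) : Type :=
  (A : Finset (Fin n)) → (N N' : ℕ) → Measure (A × Finset.Ico N N' → ℝ)

/-- A candidate conditional density `g(z, A, N, N', θ)` of a block of simulations. -/
abbrev DensityMap (n : ℕ) : Type :=
  (A : Finset (Fin n)) → (N N' : ℕ) → (A × Finset.Ico N N' → ℝ) → Param A → ℝ≥0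

/-- `g` is bounded, measurable, and continuous in its first argument uniformly in the parameter. -/
structure DensityMap.Regular {n : ℕ} (g : DensityMap n) : Prop where
  bounded : ∀ A N N', ∃ C, ∀ z θ, g A N N' z θ ≤ C
  measurable : ∀ A N N', Measurable (Function.uncurry (g A N N'))
  continuous : ∀ A N N', Equicontinuous fun θ z => g A N N' z θ

/-- The Bayesian update at step `l ≥ 1` of the law `ν` that the parameter has after step `l - 1`:
`ν` is reweighted by the density of the block of simulations made at step `l`. -/
def update {n : ℕ} (g : DensityMap n) (l : ℕ) (α : Control n)
    (ν : Path n → Measure (Param (Fin n))) (x : Path n) : Measure (Param (Fin n)) :=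
  let A := α.selected (l - 1) x
  let N := α.N (l - 1) x
  let N' := α.N l x
  let w : Param (Fin n) → ℝ≥0∞ := fun θ => g A N N' (block A N N' x) (θ.restrict A)
  (∫⁻ θ, w θ ∂(ν x))⁻¹ • (ν x).withDensity w

/-- `η` is a version of the conditional law of the parameter given the information `F_k` that the
control `α` generates up to step `k`, under the joint law `Q`. -/
structure IsPosterior {n : ℕ} (Q : Measure (Param (Fin n) × Path n)) (α : Control n) (k : ℕ)
    (η : Path n → Measure (Param (Fin n))) : Prop where
  measurable : Measurable[α.filtration k] η
  eq : ∀ B : Set (Param (Fin n)), MeasurableSet B →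
    ∀ G : Set (Path n), MeasurableSet[α.filtration k] G →
      Q (B ×ˢ G) = ∫⁻ x in G, η x B ∂Q.snd

/-- The standing assumption, for the joint law `Q` and from step `l` on. For every admissible `α'`
that coincides with `α` up to step `l`: almost surely, the law of the block of simulations of each
later step, given the parameter and the information available before that step (the law of that
block when the simulations are independent copies of the price vector), has the density `g` with
respect to `m`; and the law of the parameter given the information available
after each step belongs almost surely to `M`. -/
structure Setup.LearningAssumption (S : Setup) (mkt : Market S.ns)
    (M : Set (Measure (Param (Fin S.ns)))) (m : BaseMeasure S.ns) (g : DensityMap S.ns)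
    (Q : Measure (Param (Fin S.ns) × Path S.ns)) (l : ℕ) (α : Control S.ns) : Prop where
  regular : g.Regular
  density : ∀ α', S.Admissible α' → AgreeUpTo l α α' → ∀ k, l < k → k ≤ S.L →
    ∀ᵐ ω ∂Q,
      let A := α'.selected (k - 1) ω.2
      let N := α'.N (k - 1) ω.2
      let N' := α'.N k ω.2
      (mkt.iid ω.1).map (block A N N') =
        (m A N N').withDensity fun z => (g A N N' z (ω.1.restrict A) : ℝ≥0∞)
  posterior_mem : ∀ α', S.Admissible α' → AgreeUpTo l α α' → ∀ k, l ≤ k → k ≤ S.L →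
    ∀ η, IsPosterior Q α' k η → ∀ᵐ x ∂Q.snd, η x ∈ M

end AdaptiveES

end

noncomputable section

namespace AdaptiveES

/-!
The information after step `k` is a Borel σ-algebra of paths that is determined by its atoms: a
Borel random variable is measurable for it as soon as it is constant on the paths on which the same
simulations have been observed (compose it with the path that keeps these simulations and is `0`
elsewhere). By Bayes' rule the update is a posterior, that is,
`𝔼^ν[Φ | F_l] = 𝔼^ν[𝔼^{U}[Φ | F_{l+1}] | F_l]` with `U` the update of `ν`. Applied to the cost to
go this gives `≥` in the dynamic programming equation. For `≤`, the essential infimum that defines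
the value at `l + 1` is the pointwise infimum of a sequence of conditional costs. The first index
that is `ε`-optimal is known after step `l + 1`, so following the corresponding control is again an
admissible continuation, and it is `ε`-optimal at almost every path.
-/

section EssInf

theorem exists_seq_forall_apply_iInf_le {E : Type*} [CompleteLattice E] {I : E → ℝ≥0∞}
    (hI : Antitone I) {T : Set E} (hT : T.Nonempty) :
    ∃ r : ℕ → T, ∀ s : ℕ → T, I (⨅ k, (s k : E)) ≤ I (⨅ k, (r k : E)) := by
  have := hT.to_subtype
  let R : Set ℝ≥0∞ := Set.range fun s : ℕ → T => I (⨅ k, (s k : E))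
  obtain ⟨u, -, hu, huR⟩ := exists_seq_tendsto_sSup (Set.range_nonempty _ : R.Nonempty)
    (OrderTop.bddAbove R)
  choose s hs using huR
  let r : ℕ → T := fun k => s k.unpair.1 k.unpair.2
  have hr : sSup R ≤ I (⨅ k, (r k : E)) := le_of_tendsto' hu fun k => by
    rw [← hs k]
    refine hI (le_iInf fun j => iInf_le_of_le (Nat.pair k j) ?_)
    simp only [r, Nat.unpair_pair, le_rfl]
  exact ⟨r, fun s' => (le_sSup (Set.mem_range_self s')).trans hr⟩

variable {X : Type*} [MeasurableSpace X] {P : Measure X} {T : Set (X → ℝ≥0∞)} {V : X → ℝ≥0∞}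

theorem ae_eq_of_le_of_lintegral_inv_le [IsFiniteMeasure P] {v w : X → ℝ≥0∞} (hv : Measurable v)
    (hvw : v ≤ w) (h : ∫⁻ x, (1 + v x)⁻¹ ∂P ≤ ∫⁻ x, (1 + w x)⁻¹ ∂P) : v =ᵐ[P] w := by
  have hfin : ∫⁻ x, (1 + w x)⁻¹ ∂P ≠ ∞ := by
    refine ne_top_of_le_ne_top (measure_ne_top P Set.univ) ?_
    calc ∫⁻ x, (1 + w x)⁻¹ ∂P ≤ ∫⁻ _, 1 ∂P := lintegral_mono fun x => by simp
      _ = P Set.univ := lintegral_one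
  have hinv : (fun x => (1 + w x)⁻¹) =ᵐ[P] fun x => (1 + v x)⁻¹ :=
    ae_eq_of_ae_le_of_lintegral_le
      (.of_forall fun x => ENNReal.inv_le_inv.2 (add_le_add_right (hvw x) 1)) hfin
      (hv.const_add 1).inv.aemeasurable h
  filter_upwards [hinv] with x hx
  exact ((ENNReal.add_right_inj ENNReal.one_ne_top).1 (inv_injective hx)).symm

theorem measurable_iInf_seq (hm : ∀ f ∈ T, Measurable f) (r : ℕ → T) :
    Measurable (⨅ k, (r k : X → ℝ≥0∞)) := by
  have hr : ⨅ k, (r k : X → ℝ≥0∞) = fun x => ⨅ k, (r k : X → ℝ≥0∞) x := funext fun x => iInf_apply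
  exact hr ▸ .iInf fun k => hm _ (r k).2

theorem exists_seq_iInf_ae_le [IsFiniteMeasure P] (hT : T.Nonempty) (hm : ∀ f ∈ T, Measurable f) :
    ∃ r : ℕ → T, ∀ f ∈ T, ⨅ k, (r k : X → ℝ≥0∞) ≤ᵐ[P] f := by
  have hanti : Antitone fun v : X → ℝ≥0∞ => ∫⁻ x, (1 + v x)⁻¹ ∂P := fun v w hvw =>
    lintegral_mono fun x => ENNReal.inv_le_inv.2 (add_le_add_right (hvw x) 1)
  obtain ⟨r, hr⟩ := exists_seq_forall_apply_iInf_le hanti hT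
  refine ⟨r, fun f hf => ?_⟩
  let r' : ℕ → T
    | 0 => ⟨f, hf⟩
    | k + 1 => r k
  have hle : ⨅ k, (r' k : X → ℝ≥0∞) ≤ ⨅ k, (r k : X → ℝ≥0∞) :=
    le_iInf fun k => iInf_le (fun k => (r' k : X → ℝ≥0∞)) (k + 1)
  exact (ae_eq_of_le_of_lintegral_inv_le (measurable_iInf_seq hm r') hle (hr r')).symm.le.trans
    (.of_forall (iInf_le (fun k => (r' k : X → ℝ≥0∞)) 0))

theorem isEssInfFamily_essInfFamily (P : Measure X) [IsFiniteMeasure P] (T : Set (X → ℝ≥0∞)) :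
    IsEssInfFamily P T (essInfFamily P T) := by
  have h := exists_isEssInfFamily P T
  rw [essInfFamily, dif_pos h]
  exact h.choose_spec

theorem IsEssInfFamily.exists_seq [IsFiniteMeasure P] (hV : IsEssInfFamily P T V) (hT : T.Nonempty)
    (hm : ∀ f ∈ T, Measurable f) : ∃ r : ℕ → T, ⨅ k, (r k : X → ℝ≥0∞) =ᵐ[P] V := by
  obtain ⟨r, hr⟩ := exists_seq_iInf_ae_le (P := P) hT hm
  refine ⟨r, (hV.greatest _ (measurable_iInf_seq hm r) hr).antisymm ?_⟩
  filter_upwards [ae_all_iff.2 fun k => hV.le _ (r k).2] with x hx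
  simpa only [iInf_apply] using le_iInf hx

theorem exists_measurable_le_iInf_add {X : Type*} {mX : MeasurableSpace X} {f : ℕ → X → ℝ≥0∞}
    (hf : ∀ k, Measurable (f k)) {ε : ℝ≥0∞} (hε : ε ≠ 0) :
    ∃ τ : X → ℕ, Measurable τ ∧ ∀ x, f (τ x) x ≤ (⨅ k, f k x) + ε := by
  classical
  have hex : ∀ x, ∃ k, f k x ≤ (⨅ k, f k x) + ε := by
    intro x
    rcases eq_or_ne (⨅ k, f k x) ∞ with htop | htop
    · exact ⟨0, by simp [htop]⟩
    · obtain ⟨k, hk⟩ := iInf_lt_iff.1 (ENNReal.lt_add_right htop hε)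
      exact ⟨k, hk.le⟩
  exact ⟨fun x => Nat.find (hex x),
    measurable_find hex fun k => measurableSet_le (hf k) ((Measurable.iInf hf).add_const ε),
    fun x => Nat.find_spec (hex x)⟩

theorem ae_le_of_forall_ae_le_add {v w : X → ℝ≥0∞}
    (h : ∀ ε : ℝ≥0∞, ε ≠ 0 → ∀ᵐ x ∂P, v x ≤ w x + ε) : v ≤ᵐ[P] w := by
  have hk : ∀ᵐ x ∂P, ∀ k : ℕ, v x ≤ w x + ((k : ℝ≥0∞))⁻¹ :=
    ae_all_iff.2 fun k => h _ (ENNReal.inv_ne_zero.2 (ENNReal.natCast_ne_top k))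
  filter_upwards [hk] with x hx
  have hlim : Filter.Tendsto (fun k : ℕ => w x + (k : ℝ≥0∞)⁻¹) Filter.atTop (nhds (w x)) := by
    simpa using tendsto_const_nhds.add ENNReal.tendsto_inv_nat_nhds_zero
  exact ge_of_tendsto' hlim hx

end EssInf

section Reweight

variable {Θ : Type*} [MeasurableSpace Θ]

/-- The posterior of the prior `ν` for the likelihood `w`: the measure `ν` reweighted by `w` and
normalised. It is `0` where the evidence `∫ w dν` is `0` or `∞`. -/
def reweight (ν : Measure Θ) (w : Θ → ℝ≥0∞) : Measure Θ :=
  (∫⁻ θ, w θ ∂ν)⁻¹ • ν.withDensity w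

instance (ν : Measure Θ) (w : Θ → ℝ≥0∞) : IsZeroOrProbabilityMeasure (reweight ν w) := by
  have h : reweight ν w = (ν.withDensity w Set.univ)⁻¹ • ν.withDensity w := by
    rw [withDensity_apply _ .univ, setLIntegral_univ, reweight]
  exact h ▸ inferInstance

theorem lintegral_reweight {ν : Measure Θ} {w f : Θ → ℝ≥0∞} (hw : Measurable w)
    (hf : Measurable f) :
    ∫⁻ θ, f θ ∂(reweight ν w) = (∫⁻ θ, w θ ∂ν)⁻¹ * ∫⁻ θ, w θ * f θ ∂ν := by
  rw [reweight, lintegral_smul_measure, lintegral_withDensity_eq_lintegral_mul _ hw hf]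
  rfl

theorem lintegral_mul_lintegral_reweight {ν : Measure Θ} {w f : Θ → ℝ≥0∞} (hw : Measurable w)
    (hf : Measurable f) (hfin : ∫⁻ θ, w θ ∂ν ≠ ∞) :
    (∫⁻ θ, w θ ∂ν) * ∫⁻ θ, f θ ∂(reweight ν w) = ∫⁻ θ, w θ * f θ ∂ν := by
  rw [lintegral_reweight hw hf, ← mul_assoc]
  by_cases h0 : ∫⁻ θ, w θ ∂ν = 0
  · have hwf : ∫⁻ θ, w θ * f θ ∂ν = 0 := by
      have hw0 : w =ᵐ[ν] 0 := (lintegral_eq_zero_iff hw).1 h0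
      refine (lintegral_eq_zero_iff (hw.mul hf)).2 ?_
      filter_upwards [hw0] with θ hθ using mul_eq_zero_of_left hθ _
    rw [hwf, mul_zero]
  · rw [ENNReal.mul_inv_cancel h0 hfin, one_mul]

theorem measurable_reweight {X : Type*} [MeasurableSpace X] (ν : Kernel X Θ) [IsSFiniteKernel ν]
    {w : X → Θ → ℝ≥0∞} (hw : Measurable (Function.uncurry w)) :
    Measurable fun x => reweight (ν x) (w x) := by
  refine Measure.measurable_of_measurable_coe _ fun B hB => ?_
  have hwx : ∀ x, Measurable (w x) := fun x => hw.comp measurable_prodMk_left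
  have hmul : Measurable fun p : X × Θ => w p.1 p.2 * B.indicator 1 p.2 :=
    hw.mul ((measurable_one.indicator hB).comp measurable_snd)
  simp_rw [← lintegral_indicator_one hB, lintegral_reweight (hwx _) (measurable_one.indicator hB)]
  exact hw.lintegral_kernel_prod_right'.inv.mul hmul.lintegral_kernel_prod_right'

end Reweight

section Bayes

theorem sFinite_restrict_support {Z : Type*} [MeasurableSpace Z] {m : Measure Z} {f : Z → ℝ≥0}
    (hf : Measurable f) [IsFiniteMeasure (m.withDensity fun z => (f z : ℝ≥0∞))] :
    SFinite (m.restrict (Function.support f)) := by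
  have hs : MeasurableSet (Function.support f) := measurableSet_support hf
  rw [← withDensity_inv_same (μ := m.restrict (Function.support f)) hf.coe_nnreal_ennreal
    (by filter_upwards [ae_restrict_mem hs] with z hz using ENNReal.coe_ne_zero.2 hz)
    (.of_forall fun _ => ENNReal.coe_ne_top), ← restrict_withDensity hs]
  infer_instance

theorem sFinite_restrict_iUnion {Z : Type*} [MeasurableSpace Z] {m : Measure Z} {U : ℕ → Set Z}
    (hU : ∀ k, MeasurableSet (U k)) [∀ k, SFinite (m.restrict (U k))] :
    SFinite (m.restrict (⋃ k, U k)) := by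
  rw [← iUnion_disjointed, Measure.restrict_iUnion (disjoint_disjointed _) (.disjointed hU)]
  have : ∀ k, SFinite (m.restrict (disjointed U k)) := fun k => by
    rw [← Measure.restrict_restrict_of_subset (disjointed_subset U k)]
    infer_instance
  infer_instance

variable {Z Θ : Type*} [TopologicalSpace Z] [SecondCountableTopology Z] [MeasurableSpace Z]
  [BorelSpace Z]

-- The supports of the densities are open, so countably many of them cover all of them (Lindelöf),
-- and `m` is s-finite on the support of each density.
theorem exists_sFinite_withDensity_eq (m : Measure Z) {g : Z → Θ → ℝ≥0}
    (hg : ∀ θ, Continuous fun z => g z θ) {I : Set Θ}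
    (hI : ∀ θ ∈ I, IsFiniteMeasure (m.withDensity fun z => (g z θ : ℝ≥0∞))) :
    ∃ m' : Measure Z, SFinite m' ∧ ∀ θ ∈ I,
      (m.withDensity fun z => (g z θ : ℝ≥0∞)) = m'.withDensity fun z => (g z θ : ℝ≥0∞) := by
  let U : Θ → Set Z := fun θ => Function.support fun z => g z θ
  have hU : ∀ θ, IsOpen (U θ) := fun θ => (hg θ).isOpen_support
  obtain ⟨T, hTI, hT, hTU⟩ := TopologicalSpace.isOpen_biUnion_countable I U fun θ _ => hU θ
  have hmeas : MeasurableSet (⋃ θ ∈ T, U θ) := (isOpen_biUnion fun θ _ => hU θ).measurableSet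
  refine ⟨m.restrict (⋃ θ ∈ T, U θ), ?_, fun θ hθ => ?_⟩
  · rcases T.eq_empty_or_nonempty with rfl | hne
    · simp only [Set.biUnion_empty, Measure.restrict_empty]
      infer_instance
    · obtain ⟨t, rfl⟩ := hT.exists_eq_range hne
      rw [Set.biUnion_range]
      have : ∀ k, SFinite (m.restrict (U (t k))) := fun k => by
        have := hI (t k) (hTI ⟨k, rfl⟩)
        exact sFinite_restrict_support (hg (t k)).measurable
      exact sFinite_restrict_iUnion fun k => (hU (t k)).measurableSet
  · rw [← withDensity_indicator hmeas]
    congr 1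
    refine (Set.indicator_eq_self.2 fun z hz => ?_).symm
    rw [hTU]
    exact Set.mem_biUnion hθ (ENNReal.coe_ne_zero.1 hz)

variable [MeasurableSpace Θ] {ν : Measure Θ} {κ : Kernel Θ Z} [IsFiniteKernel κ] {m : Measure Z}
  {g : Z → Θ → ℝ≥0}

theorem exists_sFinite_lintegral_lintegral_swap [SFinite ν]
    (hg : Measurable (Function.uncurry g)) (hgc : ∀ θ, Continuous fun z => g z θ)
    (hκ : ∀ᵐ θ ∂ν, κ θ = m.withDensity fun z => (g z θ : ℝ≥0∞)) :
    ∃ m' : Measure Z, SFinite m' ∧ ∀ F : Z → Θ → ℝ≥0∞, Measurable (Function.uncurry F) →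
      ∫⁻ θ, ∫⁻ z, F z θ ∂(κ θ) ∂ν = ∫⁻ z, ∫⁻ θ, g z θ * F z θ ∂ν ∂m' := by
  obtain ⟨m', hm', hmm'⟩ := exists_sFinite_withDensity_eq m hgc
    (I := {θ | κ θ = m.withDensity fun z => (g z θ : ℝ≥0∞)})
    fun θ hθ => (hθ : κ θ = _) ▸ inferInstance
  refine ⟨m', hm', fun F hF => ?_⟩
  rw [lintegral_lintegral_swap (hg.coe_nnreal_ennreal.mul hF).aemeasurable]
  refine lintegral_congr_ae ?_
  filter_upwards [hκ] with θ hθ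
  rw [hθ, hmm' θ hθ]
  exact lintegral_withDensity_eq_lintegral_mul _
    (hg.coe_nnreal_ennreal.comp measurable_prodMk_right) (hF.comp measurable_prodMk_right)

theorem lintegral_lintegral_reweight [IsFiniteMeasure ν]
    (hg : Measurable (Function.uncurry g)) (hgc : ∀ θ, Continuous fun z => g z θ)
    (hκ : ∀ᵐ θ ∂ν, κ θ = m.withDensity fun z => (g z θ : ℝ≥0∞))
    {J : Z → Θ → ℝ≥0∞} (hJ : Measurable (Function.uncurry J)) :
    ∫⁻ θ, ∫⁻ z, ∫⁻ θ', J z θ' ∂(reweight ν fun θ' => g z θ') ∂(κ θ) ∂ν =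
      ∫⁻ θ, ∫⁻ z, J z θ ∂(κ θ) ∂ν := by
  obtain ⟨m', -, hswap⟩ := exists_sFinite_lintegral_lintegral_swap hg hgc hκ
  have hG : Measurable fun p : Z × Θ => (g p.1 p.2 : ℝ≥0∞) := hg.coe_nnreal_ennreal
  have hGz : ∀ z, Measurable fun θ => (g z θ : ℝ≥0∞) := fun z => hG.comp measurable_prodMk_left
  have hJz : ∀ z, Measurable (J z) := fun z => hJ.comp measurable_prodMk_left
  let post : Z → ℝ≥0∞ := fun z => ∫⁻ θ', J z θ' ∂(reweight ν fun θ' => g z θ')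
  have hpost : Measurable post := by
    simp_rw [post, lintegral_reweight (hGz _) (hJz _)]
    exact hG.lintegral_prod_right'.inv.mul (hG.mul hJ).lintegral_prod_right'
  have hfin : ∀ᵐ z ∂m', ∫⁻ θ, (g z θ : ℝ≥0∞) ∂ν ≠ ∞ := by
    have hmass : ∫⁻ z, ∫⁻ θ, g z θ ∂ν ∂m' = ∫⁻ θ, κ θ Set.univ ∂ν := by
      simpa using (hswap (fun _ _ => 1) measurable_const).symm
    have hle : ∫⁻ θ, κ θ Set.univ ∂ν ≤ κ.bound * ν Set.univ :=
      (lintegral_mono fun θ => κ.measure_le_bound θ _).trans_eq (lintegral_const _)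
    refine (ae_lt_top hG.lintegral_prod_right' ?_).mono fun z hz => hz.ne
    exact hmass ▸ ne_top_of_le_ne_top (ENNReal.mul_ne_top κ.bound_ne_top (measure_ne_top ν _)) hle
  rw [hswap J hJ, hswap (fun z _ => post z) (hpost.comp measurable_fst)]
  refine lintegral_congr_ae ?_
  filter_upwards [hfin] with z hz
  rw [lintegral_mul_const _ (hGz z), lintegral_mul_lintegral_reweight (hGz z) (hJz z) hz]

end Bayes

section Selection

variable {n : ℕ} {X : Type*} {mX : MeasurableSpace X}

theorem measurable_position {A : X → Finset (Fin n)} {v : X → Fin n → ℝ} (hA : Measurable A)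
    (hv : Measurable v) (i : Fin n) : Measurable fun x => position (A x) (v x) i := by
  have hpos : Measurable fun p : Finset (Fin n) × (Fin n → ℝ) => position p.1 p.2 i := by
    refine measurable_from_prod_countable_right fun A => ?_
    simp only [position, Finset.card_filter]
    refine Finset.measurable_sum _ fun k _ => Measurable.ite ?_ measurable_const measurable_const
    have hk : Measurable fun v : Fin n → ℝ => v k := measurable_pi_apply k
    have hi : Measurable fun v : Fin n → ℝ => v i := measurable_pi_apply i
    exact (measurableSet_lt hi hk).union ((measurableSet_eq_fun hk hi).inter (.const _))
  exact hpos.comp (hA.prodMk hv)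

theorem measurable_estimate {N : X → ℕ} {y : X → Path n} (hN : Measurable N) (hy : Measurable y) :
    Measurable fun x => estimate (N x) (y x) := by
  have hest : Measurable fun p : ℕ × Path n => estimate p.1 p.2 := by
    refine measurable_from_prod_countable_right fun N => measurable_pi_lambda _ fun i => ?_
    have hsum : Measurable fun y : Path n => ∑ j ∈ Finset.range N, y j i :=
      Finset.measurable_sum _ fun j _ => (measurable_pi_apply i).comp (measurable_pi_apply j)
    exact hsum.div_const (N : ℝ)
  exact hest.comp (hN.prodMk hy)

theorem measurable_filter_position_lt {A : X → Finset (Fin n)} {v : X → Fin n → ℝ} {q : X → ℕ}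
    (hA : Measurable A) (hv : Measurable v) (hq : Measurable q) :
    Measurable fun x => (A x).filter fun i => position (A x) (v x) i < q x := by
  refine measurable_finset_iff.2 fun i => ?_
  simp only [Finset.mem_filter]
  exact (measurable_finset_iff.1 hA i).and
    (measurableSet_setOfPred.1 (measurableSet_lt (measurable_position hA hv i) hq))

theorem position_congr {A : Finset (Fin n)} {v w : Fin n → ℝ} (h : ∀ i ∈ A, v i = w i)
    {i : Fin n} (hi : i ∈ A) : position A v i = position A w i := by
  unfold position
  congr 1
  exact Finset.filter_congr fun k hk => by rw [h i hi, h k hk]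

theorem estimate_congr {N : ℕ} {x y : Path n} {i : Fin n} (h : ∀ j < N, x j i = y j i) :
    estimate N x i = estimate N y i := by
  unfold estimate
  congr 1
  exact Finset.sum_congr rfl fun j hj => h j (Finset.mem_range.1 hj)

end Selection

section Information

variable {n : ℕ} {α : Control n} {k k' : ℕ}

namespace Control

/-- Each `(q (l + 1), N (l + 1))` with `l < k` is measurable for the information available after
step `l`. -/
def PredictableUpTo (α : Control n) (k : ℕ) : Prop :=
  ∀ l < k, Measurable[α.filtration l] (α.q (l + 1)) ∧ Measurable[α.filtration l] (α.N (l + 1))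

theorem PredictableUpTo.mono (h : α.PredictableUpTo k') (hk : k ≤ k') : α.PredictableUpTo k :=
  fun l hl => h l (hl.trans_le hk)

/-- The simulations that are observed at step `l + 1`, completed by `0`. -/
def reveal (α : Control n) (l : ℕ) (x : Path n) : Path n := fun j i =>
  if i ∈ α.selected l x ∧ j < α.N (l + 1) x then x j i else 0

theorem measurable_reveal (α : Control n) (l : ℕ) :
    Measurable[α.filtration (l + 1)] (α.reveal l) :=
  (comap_measurable (α.reveal l)).mono le_sup_right le_rfl

theorem selected_subset_selected (α : Control n) (hk : k ≤ k') (x : Path n) :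
    α.selected k' x ⊆ α.selected k x :=
  antitone_nat_of_succ_le (f := fun k => α.selected k x) (fun _ => Finset.filter_subset _ _) hk

theorem selected_succ_eq_filter_reveal (α : Control n) (k : ℕ) (x : Path n) :
    α.selected (k + 1) x = (α.selected k x).filter fun i =>
      position (α.selected k x) (estimate (α.N (k + 1) x) (α.reveal k x)) i < α.q (k + 1) x := by
  rw [selected]
  refine Finset.filter_congr fun i hi => ?_
  rw [position_congr (fun i hi => estimate_congr fun j hj => ?_) hi]
  rw [reveal, if_pos ⟨hi, hj⟩]

theorem filtration_mono (α : Control n) : Monotone α.filtration :=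
  monotone_nat_of_le_succ fun _ => le_sup_left

theorem PredictableUpTo.measurable_selected (h : α.PredictableUpTo k) :
    Measurable[α.filtration k] (α.selected k) := by
  induction k with
  | zero => exact @measurable_const _ _ _ (α.filtration 0) Finset.univ
  | succ k ih =>
    have hle := α.filtration_mono k.le_succ
    have hsel := (ih (h.mono k.le_succ)).mono hle le_rfl
    have hq := (h k k.lt_succ_self).1.mono hle le_rfl
    have hN := (h k k.lt_succ_self).2.mono hle le_rfl
    rw [funext (α.selected_succ_eq_filter_reveal k)]
    exact measurable_filter_position_lt hsel (measurable_estimate hN (α.measurable_reveal k)) hq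

theorem PredictableUpTo.measurableSet_revealed (h : α.PredictableUpTo (k + 1)) (i : Fin n)
    (j : ℕ) : MeasurableSet[α.filtration k] {x | i ∈ α.selected k x ∧ j < α.N (k + 1) x} :=
  .inter ((h.mono k.le_succ).measurable_selected (measurableSet_mem_finset i))
    ((h k k.lt_succ_self).2 measurableSet_Ioi)

theorem PredictableUpTo.filtration_le (h : α.PredictableUpTo k) :
    α.filtration k ≤ MeasurableSpace.pi := by
  induction k with
  | zero => exact bot_le
  | succ k ih =>
    have hle := ih (h.mono k.le_succ)
    refine sup_le hle (Measurable.comap_le ?_)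
    refine measurable_pi_lambda _ fun j => measurable_pi_lambda _ fun i => ?_
    exact Measurable.ite (hle _ (h.measurableSet_revealed i j))
      ((measurable_pi_apply i).comp (measurable_pi_apply j)) measurable_const

/-- The paths `x` and `y` agree on all that is observed along `x` up to step `k`. -/
def SameInfo (α : Control n) (k : ℕ) (x y : Path n) : Prop :=
  ∀ l < k, ∀ i ∈ α.selected l x, ∀ j < α.N (l + 1) x, x j i = y j i

theorem SameInfo.mono {x y : Path n} (h : α.SameInfo k' x y) (hk : k ≤ k') :
    α.SameInfo k x y := fun l hl => h l (hl.trans_le hk)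

end Control

theorem eq_of_measurable_cond {X Y : Type*} {m : MeasurableSpace X} [MeasurableSpace Y]
    [MeasurableSpace.SeparatesPoints Y] {x y : X}
    (h : Measurable[⊥, m] fun b : Bool => cond b x y) {f : X → Y} (hf : Measurable[m] f) :
    f x = f y := by
  have : Nonempty Y := ⟨f x⟩
  obtain ⟨c, hc⟩ := eq_const_of_measurable_bot (hf.comp h)
  exact (congrFun hc true).trans (congrFun hc false).symm

instance {X : Type*} [MeasurableSpace X] : MeasurableSpace.SeparatesPoints (Measure X) where
  separates μ _ h := Measure.ext fun B hB =>
    (h _ (Measure.measurable_coe hB (measurableSet_singleton (μ B))) rfl).symm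

namespace Control

-- No set of `α.filtration k` separates `x` from `y`, expressed as measurability of the map from
-- `Bool` onto `{x, y}` for the trivial σ-algebra.
theorem PredictableUpTo.measurable_cond_of_sameInfo (h : α.PredictableUpTo k) {x y : Path n}
    (hxy : α.SameInfo k x y) : Measurable[⊥, α.filtration k] fun b : Bool => cond b x y := by
  induction k with
  | zero => exact Measurable.of_le_map bot_le
  | succ k ih =>
    have hk := ih (h.mono k.le_succ) (hxy.mono k.le_succ)
    have hsel := eq_of_measurable_cond hk (h.mono k.le_succ).measurable_selected
    have hN := eq_of_measurable_cond hk (h k k.lt_succ_self).2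
    have hreveal : α.reveal k x = α.reveal k y := by
      ext j i
      simp only [reveal, ← hsel, ← hN]
      exact ite_congr rfl (fun hc => hxy k k.lt_succ_self i hc.1 j hc.2) fun _ => rfl
    have hconst : α.reveal k ∘ (fun b : Bool => cond b x y) = fun _ => α.reveal k x := by
      funext b
      cases b
      exacts [hreveal.symm, rfl]
    refine Measurable.of_le_map (sup_le hk.le_map (Measurable.le_map ?_))
    exact measurable_comap_iff.2 (hconst ▸ @measurable_const _ _ _ ⊥ _)

variable {Y : Type*} [MeasurableSpace Y] {f : Path n → Y}

theorem PredictableUpTo.eq_of_sameInfo [MeasurableSpace.SeparatesPoints Y]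
    (h : α.PredictableUpTo k) (hf : Measurable[α.filtration k] f) {x y : Path n}
    (hxy : α.SameInfo k x y) : f x = f y :=
  eq_of_measurable_cond (h.measurable_cond_of_sameInfo hxy) hf

/-- The simulations that are observed up to step `k`, completed by `0`. -/
def observed (α : Control n) : ℕ → Path n → Path n
  | 0, _ => 0
  | k + 1, x => fun j i =>
      if i ∈ α.selected k x ∧ j < α.N (k + 1) x then α.reveal k x j i else α.observed k x j i

theorem sameInfo_observed (α : Control n) (k : ℕ) (x : Path n) :
    α.SameInfo k x (α.observed k x) := by
  induction k with
  | zero => exact fun l hl => absurd hl l.not_lt_zero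
  | succ k ih =>
    intro l hl i hi j hj
    by_cases hc : i ∈ α.selected k x ∧ j < α.N (k + 1) x
    · simp only [observed, reveal, if_pos hc]
    · simp only [observed, if_neg hc]
      rcases Nat.lt_succ_iff_lt_or_eq.1 hl with hl | rfl
      exacts [ih l hl i hi j hj, absurd ⟨hi, hj⟩ hc]

theorem PredictableUpTo.measurable_observed (h : α.PredictableUpTo k) :
    Measurable[α.filtration k] (α.observed k) := by
  induction k with
  | zero => exact @measurable_const _ _ _ (α.filtration 0) 0
  | succ k ih =>
    have hle := α.filtration_mono k.le_succ
    have hreveal := α.measurable_reveal k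
    have hobs := (ih (h.mono k.le_succ)).mono hle le_rfl
    refine @measurable_pi_lambda _ _ _ (α.filtration (k + 1)) _ _ fun j =>
      @measurable_pi_lambda _ _ _ (α.filtration (k + 1)) _ _ fun i => ?_
    refine Measurable.ite (hle _ (h.measurableSet_revealed i j)) ?_ ?_
    · exact (measurable_pi_apply i).comp ((measurable_pi_apply j).comp hreveal)
    · exact (measurable_pi_apply i).comp ((measurable_pi_apply j).comp hobs)

theorem PredictableUpTo.measurable_filtration_of_sameInfo (h : α.PredictableUpTo k)
    (hf : Measurable f) (hs : ∀ x y, α.SameInfo k x y → f x = f y) :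
    Measurable[α.filtration k] f := by
  have hobs : f ∘ α.observed k = f := funext fun x => (hs _ _ (α.sameInfo_observed k x)).symm
  exact hobs ▸ hf.comp h.measurable_observed

end Control

end Information

section Pasting

variable {n : ℕ} {α α' α'' : Control n} {k l : ℕ}

namespace AgreeUpTo

theorem mono (h : AgreeUpTo l α α') (hk : k ≤ l) : AgreeUpTo k α α' :=
  fun j hj => h j (hj.trans hk)

theorem refl (l : ℕ) (α : Control n) : AgreeUpTo l α α := fun _ _ => ⟨rfl, rfl⟩

theorem symm (h : AgreeUpTo l α α') : AgreeUpTo l α' α :=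
  fun k hk => ⟨(h k hk).1.symm, (h k hk).2.symm⟩

theorem trans (h : AgreeUpTo l α α') (h' : AgreeUpTo l α' α'') : AgreeUpTo l α α'' :=
  fun k hk => ⟨(h' k hk).1.trans (h k hk).1, (h' k hk).2.trans (h k hk).2⟩

theorem selected_eq (h : AgreeUpTo l α α') : α'.selected l = α.selected l := by
  induction l with
  | zero => rfl
  | succ l ih =>
    funext x
    simp only [Control.selected, ih (h.mono l.le_succ), (h (l + 1) le_rfl).1,
      (h (l + 1) le_rfl).2]

theorem filtration_eq (h : AgreeUpTo l α α') : α'.filtration l = α.filtration l := by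
  induction l with
  | zero => rfl
  | succ l ih =>
    simp only [Control.filtration, ih (h.mono l.le_succ), (h.mono l.le_succ).selected_eq,
      (h (l + 1) le_rfl).2]

end AgreeUpTo

/-- The control that follows `β m` on the event `τ = m`. -/
def paste (β : ℕ → Control n) (τ : Path n → ℕ) : Control n where
  q k x := (β (τ x)).q k x
  N k x := (β (τ x)).N k x

variable {β : ℕ → Control n} {τ : Path n → ℕ}

theorem selected_paste (β : ℕ → Control n) (τ : Path n → ℕ) (k : ℕ) (x : Path n) :
    (paste β τ).selected k x = (β (τ x)).selected k x := by
  induction k with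
  | zero => rfl
  | succ k ih => simp only [Control.selected, ih]; rfl

theorem agreeUpTo_paste (hβ : ∀ m, AgreeUpTo l α (β m)) (τ : Path n → ℕ) :
    AgreeUpTo l α (paste β τ) := fun k hk =>
  ⟨funext fun x => congrFun (hβ (τ x) k hk).1 x, funext fun x => congrFun (hβ (τ x) k hk).2 x⟩

theorem measurable_filtration_paste {Y : Type*} [MeasurableSpace Y]
    [MeasurableSpace.SeparatesPoints Y] {f : ℕ → Path n → Y}
    (hβ : ∀ m, (β m).PredictableUpTo k) (hP : (paste β τ).PredictableUpTo k)
    (hτ : Measurable[(paste β τ).filtration k] τ) (hf : ∀ m, Measurable[(β m).filtration k] (f m)) :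
    Measurable[(paste β τ).filtration k] fun x => f (τ x) x := by
  have hf' : Measurable fun p : ℕ × Path n => f p.1 p.2 :=
    measurable_from_prod_countable_right fun m => (hf m).mono (hβ m).filtration_le le_rfl
  have hborel : Measurable fun x => f (τ x) x :=
    hf'.comp ((hτ.mono hP.filtration_le le_rfl).prodMk measurable_id)
  refine hP.measurable_filtration_of_sameInfo hborel fun x y hxy => ?_
  have hτxy : τ x = τ y := hP.eq_of_sameInfo hτ hxy
  have hβxy : (β (τ x)).SameInfo k x y := fun j hj i hi =>
    hxy j hj i ((selected_paste β τ j x).symm ▸ hi)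
  change f (τ x) x = f (τ y) y
  rw [← hτxy, (hβ _).eq_of_sameInfo (hf _) hβxy]

theorem predictableUpTo_paste (hβ : ∀ m, (β m).PredictableUpTo k)
    (hα : ∀ m, AgreeUpTo l α (β m)) (hτ : Measurable[α.filtration l] τ) :
    (paste β τ).PredictableUpTo k := by
  have hagree := agreeUpTo_paste hα τ
  have hagree₀ : AgreeUpTo l (β 0) (paste β τ) := (hα 0).symm.trans hagree
  induction k with
  | zero => exact fun j hj => absurd hj j.not_lt_zero
  | succ k ih =>
    have hP := ih fun m => (hβ m).mono k.le_succ
    intro j hj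
    rcases Nat.lt_succ_iff_lt_or_eq.1 hj with hj | rfl
    · exact hP j hj
    rcases Nat.lt_or_ge j l with hjl | hlj
    · rw [(hagree₀ (j + 1) hjl).1, (hagree₀ (j + 1) hjl).2, (hagree₀.mono hjl.le).filtration_eq]
      exact hβ 0 j j.lt_succ_self
    · have hτ' : Measurable[(paste β τ).filtration j] τ :=
        (hagree.filtration_eq ▸ hτ).mono ((paste β τ).filtration_mono hlj) le_rfl
      have hβj m := (hβ m).mono j.le_succ
      exact ⟨measurable_filtration_paste hβj hP hτ' fun m => (hβ m j j.lt_succ_self).1,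
        measurable_filtration_paste hβj hP hτ' fun m => (hβ m j j.lt_succ_self).2⟩

theorem paste_mem_continuations {S : Setup} {α : Control S.ns} {β : ℕ → Control S.ns}
    {τ : Path S.ns → ℕ} {l : ℕ} (hβ : ∀ m, β m ∈ S.continuations l α)
    (hτ : Measurable[α.filtration l] τ) : paste β τ ∈ S.continuations l α := by
  have hagree := fun m => (hβ m).2.1
  have hpred : ∀ m, (β m).PredictableUpTo S.L := fun m k hk =>
    ⟨(hβ m).1.q_predictable k hk, (hβ m).1.N_predictable k hk⟩
  have hP := predictableUpTo_paste hpred hagree hτ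
  have hadm x := (hβ (τ x)).1
  refine ⟨?_, agreeUpTo_paste hagree τ, fun x => (hβ (τ x)).2.2 x⟩
  exact
    { q_zero := fun x => (hadm x).q_zero x
      q_last := fun x => (hadm x).q_last x
      q_anti := fun k hk x => (hadm x).q_anti k hk x
      nw_le_q := fun k hk x => (hadm x).nw_le_q k hk x
      N_zero := fun x => (hadm x).N_zero x
      N_mono := fun k hk x => (hadm x).N_mono k hk x
      q_predictable := fun k hk => (hP k hk).1
      N_predictable := fun k hk => (hP k hk).2 }

end Pasting

section Costs

theorem measurable_finset_sup {ι X : Type*} [Finite ι] [MeasurableSpace X] {s : X → Finset ι}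
    {f : X → ι → ℝ≥0∞} (hs : Measurable s) (hf : ∀ i, Measurable fun x => f x i) :
    Measurable fun x => (s x).sup (f x) := by
  classical
  have hsup : (fun x => (s x).sup (f x)) = fun x => ⨆ i, if i ∈ s x then f x i else 0 := by
    ext x
    rw [Finset.sup_eq_iSup]
    refine iSup_congr fun i => ?_
    by_cases h : i ∈ s x <;> simp [h]
  rw [hsup]
  exact Measurable.iSup fun i =>
    Measurable.ite (hs (measurableSet_mem_finset i)) (hf i) measurable_const

theorem measurable_mean {n : ℕ} : Measurable fun ω : Param (Fin n) × Path n => ω.1.1 :=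
  measurable_fst.comp measurable_fst

theorem measurable_sigmaSq {n : ℕ} (i k : Fin n) :
    Measurable fun θ : Param (Fin n) => sigmaSq θ i k := by
  have h : ∀ i k, Measurable fun θ : Param (Fin n) => θ.2.1 i k := fun i k =>
    (measurable_pi_apply k).comp ((measurable_pi_apply i).comp
      (measurable_subtype_coe.comp measurable_snd))
  unfold sigmaSq
  exact ((h i i).add (h k k)).sub ((h i k).const_mul 2)

variable {S : Setup} {α α' : Control S.ns} {k l : ℕ} {x y : Path S.ns}

namespace Setup.Admissible

theorem predictableUpTo (h : S.Admissible α) (hk : k ≤ S.L) : α.PredictableUpTo k :=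
  fun l hl => ⟨h.q_predictable l (hl.trans_le hk), h.N_predictable l (hl.trans_le hk)⟩

theorem filtration_le (h : S.Admissible α) (hk : k ≤ S.L) :
    α.filtration k ≤ MeasurableSpace.pi := (h.predictableUpTo hk).filtration_le

theorem measurable_q_filtration (h : S.Admissible α) (hk : k ≤ S.L) :
    Measurable[α.filtration (k - 1)] (α.q k) := by
  cases k with
  | zero => rw [funext h.q_zero]; exact measurable_const
  | succ k => exact h.q_predictable k hk

theorem measurable_N_filtration (h : S.Admissible α) (hk : k ≤ S.L) :
    Measurable[α.filtration (k - 1)] (α.N k) := by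
  cases k with
  | zero => rw [funext h.N_zero]; exact measurable_const
  | succ k => exact h.N_predictable k hk

theorem measurable_q (h : S.Admissible α) (hk : k ≤ S.L) : Measurable (α.q k) :=
  (h.measurable_q_filtration hk).mono (h.filtration_le ((k.sub_le 1).trans hk)) le_rfl

theorem measurable_N (h : S.Admissible α) (hk : k ≤ S.L) : Measurable (α.N k) :=
  (h.measurable_N_filtration hk).mono (h.filtration_le ((k.sub_le 1).trans hk)) le_rfl

theorem measurable_selected (h : S.Admissible α) (hk : k ≤ S.L) : Measurable (α.selected k) :=
  (h.predictableUpTo hk).measurable_selected.mono (h.filtration_le hk) le_rfl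

theorem measurable_rho (h : S.Admissible α) (hk : k ≤ S.L) (i j : Fin S.ns) :
    Measurable fun ω : Param (Fin S.ns) × Path S.ns => rho α k ω.1 ω.2 i j := by
  have hsnd : Measurable (Prod.snd : Param (Fin S.ns) × Path S.ns → Path S.ns) := measurable_snd
  have hN := (h.measurable_N hk).comp hsnd
  have hN' := (h.measurable_N ((k.sub_le 1).trans hk)).comp hsnd
  have hN_cast := measurable_from_top (f := fun m : ℕ => (m : ℝ)) |>.comp hN
  have hN'_cast := measurable_from_top (f := fun m : ℕ => (m : ℝ)) |>.comp hN'
  have hest := fun i => (measurable_pi_apply i).comp (measurable_estimate hN' hsnd)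
  have hμ := fun i => (measurable_pi_apply i).comp (measurable_mean (n := S.ns))
  exact ((hμ i).sub (hμ j)).add
    ((hN'_cast.div (hN_cast.sub hN'_cast)).mul ((hest i).sub (hest j)))

theorem measurable_stepCost (h : S.Admissible α) (hk : k ≤ S.L) :
    Measurable (S.stepCost α k) := by
  have hk' : k - 1 ≤ S.L := (k.sub_le 1).trans hk
  have hsnd : Measurable (Prod.snd : Param (Fin S.ns) × Path S.ns → Path S.ns) := measurable_snd
  have hq := (h.measurable_q hk).comp hsnd
  have hq' := (h.measurable_q hk').comp hsnd
  have hN := measurable_from_top (f := fun m : ℕ => (m : ℝ)) |>.comp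
    ((h.measurable_N hk).comp hsnd)
  have hN' := measurable_from_top (f := fun m : ℕ => (m : ℝ)) |>.comp
    ((h.measurable_N hk').comp hsnd)
  have hsel := (h.measurable_selected hk').comp hsnd
  have hmem := measurable_finset_iff.1 hsel
  have hμ := fun i => (measurable_pi_apply i).comp (measurable_mean (n := S.ns))
  have hpos := measurable_position hsel measurable_mean
  unfold Setup.stepCost
  refine Measurable.mul ?_ (measurable_finset_sup (measurable_finset_iff.2 fun ik => ?_) ?_)
  · exact (measurable_from_top (f := fun m : ℕ => (m : ℝ≥0∞))).comp (hq'.sub hq)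
  · simp only [Finset.mem_filter, Finset.mem_product]
    refine ((hmem _).and (hmem _)).and (measurableSet_setOfPred.1 ?_)
    exact (measurableSet_lt (hpos _) measurable_const).inter
      ((measurableSet_le hq (hpos _)).inter (measurableSet_lt (hpos _) hq'))
  · intro ik
    have hr := h.measurable_rho hk ik.1 ik.2
    have hσ : Measurable fun ω : Param (Fin S.ns) × Path S.ns => sigmaSq ω.1 ik.1 ik.2 :=
      (measurable_sigmaSq ik.1 ik.2).comp measurable_fst
    have hexponent := ((hN.sub hN').mul (hr.pow_const 2)).div
      ((hσ.add (hr.const_mul S.c)).const_mul 2)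
    exact ENNReal.measurable_ofReal.comp ((((hμ _).sub (hμ _)).pow_const _).mul
      (Measurable.ite (measurableSet_le measurable_const hr)
        (Real.measurable_exp.comp hexponent.neg) measurable_const))

theorem measurable_finalCost (h : S.Admissible α) : Measurable (S.finalCost α) := by
  have hsnd : Measurable (Prod.snd : Param (Fin S.ns) × Path S.ns → Path S.ns) := measurable_snd
  have hμ := fun i => (measurable_pi_apply i).comp (measurable_mean (n := S.ns))
  have hest := measurable_estimate ((h.measurable_N le_rfl).comp hsnd) hsnd
  have hsum : Measurable fun p : Finset (Fin S.ns) × Param (Fin S.ns) × Path S.ns =>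
      ∑ i ∈ p.1, (estimate (α.N S.L p.2.2) p.2.2 i - p.2.1.1 i) :=
    measurable_from_prod_countable_right fun A => Finset.measurable_sum _ fun i _ =>
      ((measurable_pi_apply i).comp hest).sub (hμ i)
  have hsel := (h.measurable_selected (S.L.sub_le 1)).comp hsnd
  exact ENNReal.measurable_ofReal.comp
    (((hsum.comp (hsel.prodMk measurable_id)).const_mul _).abs.pow_const _)

theorem measurable_costToGo (h : S.Admissible α) (l : ℕ) : Measurable (S.costToGo l α) :=
  h.measurable_finalCost.add (Finset.measurable_fun_sum _ fun _ hk =>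
    h.measurable_stepCost ((Finset.mem_Icc.1 hk).2.trans (S.L.sub_le 1)))

theorem q_eq (h : S.Admissible α) (hk : k ≤ S.L) (hxy : α.SameInfo (k - 1) x y) :
    α.q k x = α.q k y :=
  (h.predictableUpTo ((k.sub_le 1).trans hk)).eq_of_sameInfo (h.measurable_q_filtration hk) hxy

theorem N_eq (h : S.Admissible α) (hk : k ≤ S.L) (hxy : α.SameInfo (k - 1) x y) :
    α.N k x = α.N k y :=
  (h.predictableUpTo ((k.sub_le 1).trans hk)).eq_of_sameInfo (h.measurable_N_filtration hk) hxy

theorem selected_eq (h : S.Admissible α) (hk : k ≤ S.L) (hxy : α.SameInfo k x y) :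
    α.selected k x = α.selected k y :=
  (h.predictableUpTo hk).eq_of_sameInfo (h.predictableUpTo hk).measurable_selected hxy

theorem estimate_eq (h : S.Admissible α) (hxy : α.SameInfo k x y) {i : Fin S.ns}
    (hi : i ∈ α.selected k x) : estimate (α.N k x) x i = estimate (α.N k x) y i := by
  refine estimate_congr fun j hj => ?_
  cases k with
  | zero => exact absurd (h.N_zero x ▸ hj) j.not_lt_zero
  | succ k => exact hxy k k.lt_succ_self i (α.selected_subset_selected k.le_succ x hi) j hj

theorem stepCost_eq (h : S.Admissible α) (hk : k ≤ S.L) (hxy : α.SameInfo (k - 1) x y)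
    (θ : Param (Fin S.ns)) : S.stepCost α k (θ, x) = S.stepCost α k (θ, y) := by
  have hk' : k - 1 ≤ S.L := (k.sub_le 1).trans hk
  have hxy' := hxy.mono (Nat.sub_le (k - 1) 1)
  simp only [Setup.stepCost]
  rw [← h.selected_eq hk' hxy, ← h.q_eq hk hxy, ← h.q_eq hk' hxy', ← h.N_eq hk hxy,
    ← h.N_eq hk' hxy']
  congr 1
  refine Finset.sup_congr rfl fun ik hik => ?_
  have hik' := Finset.mem_product.1 (Finset.mem_filter.1 hik).1
  have hr : rho α k θ x ik.1 ik.2 = rho α k θ y ik.1 ik.2 := by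
    unfold rho
    rw [h.estimate_eq hxy hik'.1, h.estimate_eq hxy hik'.2, h.N_eq hk hxy, h.N_eq hk' hxy']
  rw [hr]

theorem finalCost_eq (h : S.Admissible α) (hxy : α.SameInfo S.L x y) (θ : Param (Fin S.ns)) :
    S.finalCost α (θ, x) = S.finalCost α (θ, y) := by
  have hxy' := hxy.mono (S.L.sub_le 1)
  have hL : S.L - 1 + 1 = S.L := Nat.sub_add_cancel S.one_le_L
  simp only [Setup.finalCost]
  rw [← h.selected_eq (S.L.sub_le 1) hxy', ← h.N_eq le_rfl hxy']
  refine congrArg (fun r : ℝ => ENNReal.ofReal (|1 / (S.nw : ℝ) * r| ^ S.p)) ?_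
  refine Finset.sum_congr rfl fun i hi => congrArg (· - θ.1 i) (estimate_congr fun j hj => ?_)
  exact hxy (S.L - 1) (Nat.sub_lt S.one_le_L one_pos) i hi j (hL.symm ▸ hj)

theorem costToGo_eq (h : S.Admissible α) (l : ℕ) (hxy : α.SameInfo S.L x y)
    (θ : Param (Fin S.ns)) : S.costToGo l α (θ, x) = S.costToGo l α (θ, y) := by
  refine congrArg₂ (· + ·) (h.finalCost_eq hxy θ) (Finset.sum_congr rfl fun k hk => ?_)
  have hk' : k ≤ S.L := (Finset.mem_Icc.1 hk).2.trans (S.L.sub_le 1)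
  exact h.stepCost_eq hk' (hxy.mono ((k.sub_le 1).trans hk')) θ

end Setup.Admissible

theorem Setup.costToGo_succ (S : Setup) (hl : l + 2 ≤ S.L) (α : Control S.ns)
    (ω : Param (Fin S.ns) × Path S.ns) :
    S.costToGo l α ω = S.costToGo (l + 1) α ω + S.stepCost α (l + 1) ω := by
  rw [costToGo, costToGo, ← Finset.insert_Icc_succ_left_eq_Icc (by lia : l + 1 ≤ S.L - 1),
    Finset.sum_insert (by simp), add_comm (S.stepCost α (l + 1) ω), ← add_assoc]
  rfl

theorem costToGo_paste (l : ℕ) (β : ℕ → Control S.ns) (τ : Path S.ns → ℕ)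
    (θ : Param (Fin S.ns)) (x : Path S.ns) :
    S.costToGo l (paste β τ) (θ, x) = S.costToGo l (β (τ x)) (θ, x) := by
  have hfinal : S.finalCost (paste β τ) (θ, x) = S.finalCost (β (τ x)) (θ, x) := by
    simp only [Setup.finalCost, selected_paste]; rfl
  have hstep : ∀ k, S.stepCost (paste β τ) k (θ, x) = S.stepCost (β (τ x)) k (θ, x) := by
    intro k; simp only [Setup.stepCost, selected_paste]; rfl
  simp only [Setup.costToGo, hfinal, hstep]

theorem AgreeUpTo.stepCost_eq (h : AgreeUpTo k α α') : S.stepCost α' k = S.stepCost α k := by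
  funext ω
  have hk := k.sub_le 1
  have hρ : rho α' k = rho α k := by
    funext θ x i j
    simp only [rho, (h k le_rfl).2, (h _ hk).2]
  simp only [Setup.stepCost, hρ, (h k le_rfl).1, (h k le_rfl).2, (h _ hk).1, (h _ hk).2,
    (h.mono hk).selected_eq]

end Costs

section Resampling

variable {n : ℕ} {X : Type*} [MeasurableSpace X]

theorem measurable_splice {N : X → ℕ} {x y : X → Path n} (hN : Measurable N) (hx : Measurable x)
    (hy : Measurable y) : Measurable fun w => splice (N w) (x w) (y w) :=
  measurable_pi_lambda _ fun j => Measurable.ite (measurableSet_lt measurable_const hN)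
    ((measurable_pi_apply j).comp hx) ((measurable_pi_apply j).comp hy)

theorem splice_splice_left (N : ℕ) (x y z : Path n) :
    splice N (splice N x y) z = splice N x z := by
  funext j
  by_cases h : j < N <;> simp [splice, h]

theorem splice_splice_of_le {N N' : ℕ} (h : N ≤ N') (x y z : Path n) :
    splice N' (splice N x y) z = splice N x (splice N' y z) := by
  funext j
  by_cases hN : j < N
  · simp [splice, hN, hN.trans_le h]
  · by_cases hN' : j < N' <;> simp [splice, hN, hN']

theorem map_splice_infinitePi (μ : Measure (Fin n → ℝ)) [IsProbabilityMeasure μ] (N : ℕ) :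
    ((Measure.infinitePi fun _ : ℕ => μ).prod (Measure.infinitePi fun _ : ℕ => μ)).map
      (fun p => splice N p.1 p.2) = Measure.infinitePi fun _ : ℕ => μ := by
  refine Measure.eq_infinitePi _ fun s t ht => ?_
  rw [Measure.map_apply (measurable_splice measurable_const measurable_fst measurable_snd)
    (MeasurableSet.pi s.countable_toSet fun i _ => ht i)]
  have hpre : (fun p : Path n × Path n => splice N p.1 p.2) ⁻¹' (s : Set ℕ).pi t =
      ((s.filter (· < N) : Finset ℕ) : Set ℕ).pi t ×ˢ
        ((s.filter (¬ · < N) : Finset ℕ) : Set ℕ).pi t := by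
    ext p
    simp only [Set.mem_preimage, Set.mem_pi, Set.mem_prod, Finset.mem_coe, Finset.mem_filter,
      splice, and_imp, ← forall_and]
    refine forall₂_congr fun j _ => ?_
    by_cases hj : j < N <;> simp [hj]
  rw [hpre, Measure.prod_prod, Measure.infinitePi_pi _ fun i _ => ht i,
    Measure.infinitePi_pi _ fun i _ => ht i]
  exact Finset.prod_filter_mul_prod_filter_not s (· < N) fun i => μ (t i)

instance (mkt : Market n) : IsMarkovKernel mkt.iid := by
  have := mkt.isMarkov
  exact ⟨fun θ => inferInstanceAs (IsProbabilityMeasure (Measure.infinitePi fun _ => mkt.law θ))⟩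

theorem lintegral_iid_splice (mkt : Market n) (θ : Param (Fin n)) (N : ℕ) {F : Path n → ℝ≥0∞}
    (hF : Measurable F) :
    ∫⁻ y, ∫⁻ z, F (splice N y z) ∂(mkt.iid θ) ∂(mkt.iid θ) = ∫⁻ y, F y ∂(mkt.iid θ) := by
  have := mkt.isMarkov
  have hs : Measurable fun p : Path n × Path n => splice N p.1 p.2 :=
    measurable_splice measurable_const measurable_fst measurable_snd
  have hmap : ((mkt.iid θ).prod (mkt.iid θ)).map (fun p => splice N p.1 p.2) = mkt.iid θ :=
    map_splice_infinitePi (mkt.law θ) N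
  conv_rhs => rw [← hmap]
  rw [lintegral_map hF hs]
  exact (lintegral_prod _ (hF.comp hs).aemeasurable).symm

/-- The conditional expectation of `Φ` given the parameter and the first `N` simulations: the later
simulations are drawn afresh. -/
def resample (mkt : Market n) (N : Path n → ℕ) (Φ : Param (Fin n) × Path n → ℝ≥0∞)
    (ω : Param (Fin n) × Path n) : ℝ≥0∞ :=
  ∫⁻ y, Φ (ω.1, splice (N ω.2) ω.2 y) ∂(mkt.iid ω.1)

variable (mkt : Market n) {N : Path n → ℕ} {Φ : Param (Fin n) × Path n → ℝ≥0∞}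

theorem measurable_prodMk_splice (θ : Param (Fin n)) (N : ℕ) (x : Path n) :
    Measurable fun y => (θ, splice N x y) :=
  measurable_const.prodMk (measurable_splice measurable_const measurable_const measurable_id)

theorem measurable_resample (hN : Measurable N) (hΦ : Measurable Φ) :
    Measurable (resample mkt N Φ) := by
  have hω : Measurable fun w : (Param (Fin n) × Path n) × Path n => w.1.2 :=
    measurable_snd.comp measurable_fst
  have hΦ' : Measurable fun w : (Param (Fin n) × Path n) × Path n =>
      Φ (w.1.1, splice (N w.1.2) w.1.2 w.2) :=
    hΦ.comp ((measurable_fst.comp measurable_fst).prodMk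
      (measurable_splice (hN.comp hω) hω measurable_snd))
  exact hΦ'.lintegral_kernel_prod_right' (κ := mkt.iid.comap Prod.fst measurable_fst)

end Resampling

section CondE

variable {n : ℕ} {mkt : Market n} {α : Control n} {l : ℕ} {Φ Ψ : Param (Fin n) × Path n → ℝ≥0∞}

theorem measurable_condE (hN : Measurable (α.N l)) {η : Path n → Measure (Param (Fin n))}
    [∀ x, IsZeroOrProbabilityMeasure (η x)] (hη : Measurable η) (hΦ : Measurable Φ) :
    Measurable (condE mkt l α η Φ) := by
  let κ : Kernel (Path n) (Param (Fin n)) := ⟨η, hη⟩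
  have : IsFiniteKernel κ := ⟨1, ENNReal.one_lt_top, fun x => prob_le_one (μ := η x)⟩
  exact ((measurable_resample mkt hN hΦ).comp measurable_swap).lintegral_kernel_prod_right' (κ := κ)

theorem condE_add (hN : Measurable (α.N l)) (η : Path n → Measure (Param (Fin n)))
    (hΦ : Measurable Φ) (x : Path n) :
    condE mkt l α η (fun ω => Φ ω + Ψ ω) x = condE mkt l α η Φ x + condE mkt l α η Ψ x := by
  have hresample : ∀ θ, resample mkt (α.N l) (fun ω => Φ ω + Ψ ω) (θ, x) =
      resample mkt (α.N l) Φ (θ, x) + resample mkt (α.N l) Ψ (θ, x) := fun θ =>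
    lintegral_add_left (hΦ.comp (measurable_prodMk_splice θ _ x)) _
  exact (lintegral_congr hresample).trans
    (lintegral_add_left ((measurable_resample mkt hN hΦ).comp measurable_prodMk_right) _)

theorem condE_of_forall_eq {η : Path n → Measure (Param (Fin n))} {x : Path n}
    [IsProbabilityMeasure (η x)] {c : ℝ≥0∞} (h : ∀ θ y, Φ (θ, splice (α.N l x) x y) = c) :
    condE mkt l α η Φ x = c := by
  simp only [condE, h, lintegral_const, measure_univ, mul_one]

section StepLaw

variable {ν : Kernel (Path n) (Param (Fin n))} [IsMarkovKernel ν] {past : Measure (Path n)}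

theorem measurable_stepLaw_path (hN : Measurable (α.N l)) :
    Measurable fun w : (Path n × Param (Fin n)) × Path n =>
      (w.1.2, splice (α.N l w.1.1) w.1.1 w.2) :=
  have hx := measurable_fst.comp measurable_fst
  (measurable_snd.comp measurable_fst).prodMk (measurable_splice (hN.comp hx) hx measurable_snd)

theorem lintegral_stepLaw [SFinite past] (hN : Measurable (α.N l)) (hΦ : Measurable Φ) :
    ∫⁻ ω, Φ ω ∂(stepLaw mkt l α ν past) = ∫⁻ x, condE mkt l α ν Φ x ∂past := by
  have hf := measurable_stepLaw_path hN
  rw [stepLaw, lintegral_map hΦ hf]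
  refine (Measure.lintegral_compProd (hΦ.comp hf)).trans ?_
  exact Measure.lintegral_compProd ((measurable_resample mkt hN hΦ).comp measurable_swap)

instance [IsFiniteMeasure past] : IsFiniteMeasure (stepLaw mkt l α ν past) := by
  unfold stepLaw
  infer_instance

end StepLaw

end CondE

namespace Setup.Admissible

variable {S : Setup} {mkt : Market S.ns} {α : Control S.ns} {k k' l : ℕ}
  {Φ Ψ : Param (Fin S.ns) × Path S.ns → ℝ≥0∞}

theorem N_le (h : S.Admissible α) (hk : k ≤ k') (hk' : k' ≤ S.L) (x : Path S.ns) :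
    α.N k x ≤ α.N k' x := by
  induction k', hk using Nat.le_induction with
  | base => exact le_rfl
  | succ j _ ih => exact (ih (Nat.le_of_succ_le hk')).trans (h.N_mono j hk' x)

theorem sameInfo_splice (h : S.Admissible α) (hk : k ≤ S.L) (x y : Path S.ns) :
    α.SameInfo k x (splice (α.N k x) x y) := by
  intro l hl i _ j hj
  rw [splice, if_pos (hj.trans_le (h.N_le hl hk x))]

theorem condE_splice (h : S.Admissible α) (hk : k ≤ S.L)
    {η : Path S.ns → Measure (Param (Fin S.ns))} (hη : Measurable[α.filtration k] η)
    (Φ : Param (Fin S.ns) × Path S.ns → ℝ≥0∞) (x y : Path S.ns) :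
    condE mkt k α η Φ (splice (α.N k x) x y) = condE mkt k α η Φ x := by
  have hs := h.sameInfo_splice hk x y
  unfold condE
  rw [← (h.predictableUpTo hk).eq_of_sameInfo hη hs, ← h.N_eq hk (hs.mono (k.sub_le 1))]
  simp only [splice_splice_left]

variable {ν : Kernel (Path S.ns) (Param (Fin S.ns))} [IsMarkovKernel ν]
  {past : Measure (Path S.ns)} [SFinite past]

theorem lintegral_condE (h : S.Admissible α) (hl : l ≤ S.L) (hν : Measurable[α.filtration l] ν)
    (hΦ : Measurable Φ) :
    ∫⁻ x, condE mkt l α ν Φ x ∂(stepLaw mkt l α ν past).snd =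
      ∫⁻ ω, Φ ω ∂(stepLaw mkt l α ν past) := by
  have hN := h.measurable_N hl
  have hm : Measurable (condE mkt l α ν Φ) := measurable_condE hN ν.measurable hΦ
  rw [Measure.snd, lintegral_map hm measurable_snd, lintegral_stepLaw hN hΦ]
  refine (lintegral_stepLaw hN (hm.comp measurable_snd)).trans (lintegral_congr fun x => ?_)
  exact condE_of_forall_eq fun _ y => h.condE_splice hl hν Φ x y

theorem ae_of_ae_stepLaw (h : S.Admissible α) (hl : l ≤ S.L) (hν : Measurable[α.filtration l] ν)
    {p : Param (Fin S.ns) × Path S.ns → Prop} (hp : ∀ᵐ ω ∂(stepLaw mkt l α ν past), p ω) :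
    ∀ᵐ x ∂(stepLaw mkt l α ν past).snd, ∀ᵐ θ ∂(ν x), ∀ᵐ y ∂(mkt.iid θ),
      p (θ, splice (α.N l x) x y) := by
  obtain ⟨E, hpE, hE, hE0⟩ := exists_measurable_superset_of_null hp
  have hΦ : Measurable (E.indicator (1 : Param (Fin S.ns) × Path S.ns → ℝ≥0∞)) :=
    measurable_one.indicator hE
  have hnull := h.lintegral_condE (mkt := mkt) (past := past) hl hν hΦ
  rw [lintegral_indicator_one hE, hE0,
    lintegral_eq_zero_iff (measurable_condE (h.measurable_N hl) ν.measurable hΦ)] at hnull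
  filter_upwards [hnull] with x hx
  have hf : Measurable fun w : Param (Fin S.ns) × Path S.ns =>
      (w.1, splice (α.N l x) x w.2) :=
    measurable_fst.prodMk (measurable_splice measurable_const measurable_const measurable_snd)
  have hcond : (ν x ⊗ₘ mkt.iid) ((fun w => (w.1, splice (α.N l x) x w.2)) ⁻¹' E) = 0 := by
    rw [← lintegral_indicator_one (hf hE),
      Measure.lintegral_compProd (measurable_one.indicator (hf hE))]
    exact hx
  have hae : ∀ᵐ w ∂(ν x ⊗ₘ mkt.iid), p (w.1, splice (α.N l x) x w.2) :=
    measure_mono_null (Set.preimage_mono hpE) hcond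
  exact Measure.ae_ae_of_ae_compProd hae

theorem condE_mono_ae (h : S.Admissible α) (hl : l ≤ S.L) (hν : Measurable[α.filtration l] ν)
    (hΦΨ : Φ ≤ᵐ[stepLaw mkt l α ν past] Ψ) :
    condE mkt l α ν Φ ≤ᵐ[(stepLaw mkt l α ν past).snd] condE mkt l α ν Ψ := by
  filter_upwards [h.ae_of_ae_stepLaw hl hν hΦΨ] with x hx
  refine lintegral_mono_ae ?_
  filter_upwards [hx] with θ hθ using lintegral_mono_ae hθ

end Setup.Admissible

section Update

variable {n : ℕ}

theorem measurable_restrict (A : Finset (Fin n)) :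
    Measurable (Param.restrict A : Param (Fin n) → Param A) := by
  have hcov : Measurable fun θ : Param (Fin n) => (θ.2 : Fin n → Fin n → ℝ) :=
    measurable_subtype_coe.comp measurable_snd
  refine Measurable.prodMk ?_ (Measurable.subtype_mk ?_)
  · exact measurable_pi_lambda _ fun i => (measurable_pi_apply _).comp measurable_fst
  · exact measurable_pi_lambda _ fun i => measurable_pi_lambda _ fun k =>
      (measurable_pi_apply _).comp ((measurable_pi_apply _).comp hcov)

theorem measurable_block (A : Finset (Fin n)) (N N' : ℕ) : Measurable (block A N N') :=
  measurable_pi_lambda _ fun _ => (measurable_pi_apply _).comp (measurable_pi_apply _)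

/-- The path `x` with its block of simulations number `N + 1, …, N'` in the scenarios of `A`
replaced by `z`. -/
def setBlock (A : Finset (Fin n)) (N N' : ℕ) (x : Path n) (z : A × Finset.Ico N N' → ℝ) :
    Path n := fun j i =>
  if h : i ∈ A ∧ j ∈ Finset.Ico N N' then z (⟨i, h.1⟩, ⟨j, h.2⟩) else x j i

theorem measurable_setBlock (A : Finset (Fin n)) (N N' : ℕ) (x : Path n) :
    Measurable (setBlock A N N' x) := by
  refine measurable_pi_lambda _ fun j => measurable_pi_lambda _ fun i => ?_
  unfold setBlock
  split_ifs
  exacts [measurable_pi_apply _, measurable_const]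

theorem block_setBlock (A : Finset (Fin n)) (N N' : ℕ) (x : Path n)
    (z : A × Finset.Ico N N' → ℝ) : block A N N' (setBlock A N N' x z) = z := by
  funext ⟨i, j⟩
  exact dif_pos ⟨i.2, j.2⟩

variable {g : DensityMap n}

theorem measurable_density {A : Finset (Fin n)} {N N' : ℕ}
    (hg : Measurable (Function.uncurry (g A N N'))) :
    Measurable (Function.uncurry fun z (θ : Param (Fin n)) => g A N N' z (θ.restrict A)) :=
  hg.comp (measurable_fst.prodMk ((measurable_restrict A).comp measurable_snd))

theorem update_succ (g : DensityMap n) (l : ℕ) (α : Control n)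
    (ν : Path n → Measure (Param (Fin n))) (x : Path n) :
    update g (l + 1) α ν x = reweight (ν x) fun θ =>
      g (α.selected l x) (α.N l x) (α.N (l + 1) x)
        (block (α.selected l x) (α.N l x) (α.N (l + 1) x) x) (θ.restrict (α.selected l x)) :=
  rfl

instance (l : ℕ) (α : Control n) (ν : Path n → Measure (Param (Fin n))) (x : Path n) :
    IsZeroOrProbabilityMeasure (update g l α ν x) :=
  inferInstanceAs (IsZeroOrProbabilityMeasure (reweight _ _))

/-- At the parameter `θ`, the block of the simulations number `N + 1, …, N'` in the scenarios of
`A` has the density `g` with respect to `m`. -/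
def HasBlockDensity (mkt : Market n) (m : BaseMeasure n) (g : DensityMap n) (A : Finset (Fin n))
    (N N' : ℕ) (θ : Param (Fin n)) : Prop :=
  (mkt.iid θ).map (block A N N') =
    (m A N N').withDensity fun z => (g A N N' z (θ.restrict A) : ℝ≥0∞)

namespace Setup.Admissible

variable {S : Setup} {mkt : Market S.ns} {α : Control S.ns} {g : DensityMap S.ns} {l : ℕ}
  {x y : Path S.ns}

theorem sameInfo_setBlock (h : S.Admissible α) (hl : l ≤ S.L) (A : Finset (Fin S.ns)) (N' : ℕ)
    (x : Path S.ns) (z : A × Finset.Ico (α.N l x) N' → ℝ) :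
    α.SameInfo l x (setBlock A (α.N l x) N' x z) := by
  intro k hk i _ j hj
  rw [setBlock, dif_neg fun hc => ?_]
  exact (hj.trans_le (h.N_le hk hl x)).not_ge (Finset.mem_Ico.1 hc.2).1

theorem sameInfo_splice_setBlock (h : S.Admissible α) (hl : l + 1 ≤ S.L) (x y : Path S.ns) :
    α.SameInfo (l + 1) (splice (α.N l x) x y)
      (setBlock (α.selected l x) (α.N l x) (α.N (l + 1) x) x (block _ _ _ y)) := by
  intro k hk i hi j hj
  have hl' := Nat.le_of_succ_le hl
  have hs := h.sameInfo_splice hl' x y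
  by_cases hjN : j < α.N l x
  · have hc : ¬ (i ∈ α.selected l x ∧ j ∈ Finset.Ico (α.N l x) (α.N (l + 1) x)) := fun hc =>
      hjN.not_ge (Finset.mem_Ico.1 hc.2).1
    rw [splice, if_pos hjN, setBlock, dif_neg hc]
  · obtain rfl : k = l := by
      by_contra hne
      have hkl : k + 1 ≤ l := Nat.lt_of_le_of_ne (Nat.le_of_lt_succ hk) hne
      rw [← h.N_eq (hkl.trans hl') (hs.mono (Nat.le_of_succ_le hkl))] at hj
      exact hjN (hj.trans_le (h.N_le hkl hl' x))
    rw [← h.selected_eq hl' hs] at hi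
    rw [← h.N_eq hl hs] at hj
    rw [splice, if_neg hjN, setBlock, dif_pos ⟨hi, Finset.mem_Ico.2 ⟨not_lt.1 hjN, hj⟩⟩]
    rfl

theorem lintegral_iid_splice_eq_lintegral_setBlock (h : S.Admissible α) (hl : l + 1 ≤ S.L)
    {F : Path S.ns → ℝ≥0∞} (hF : Measurable F)
    (hFs : ∀ x y, α.SameInfo (l + 1) x y → F x = F y) (θ : Param (Fin S.ns)) (x : Path S.ns) :
    ∫⁻ y, F (splice (α.N l x) x y) ∂(mkt.iid θ) =
      ∫⁻ z, F (setBlock (α.selected l x) (α.N l x) (α.N (l + 1) x) x z)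
        ∂(mkt.iid.map (block (α.selected l x) (α.N l x) (α.N (l + 1) x)) θ) := by
  have hFm := hF.comp (measurable_setBlock (α.selected l x) (α.N l x) (α.N (l + 1) x) x)
  rw [Kernel.map_apply _ (measurable_block _ _ _)]
  refine Eq.trans ?_ (lintegral_map hFm (measurable_block _ _ _)).symm
  exact lintegral_congr fun y => hFs _ _ (h.sameInfo_splice_setBlock hl x y)

section

variable {ν : Path S.ns → Measure (Param (Fin S.ns))}

theorem update_setBlock (h : S.Admissible α) (hl : l + 1 ≤ S.L)
    (hν : Measurable[α.filtration l] ν) (g : DensityMap S.ns) (x : Path S.ns)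
    (z : α.selected l x × Finset.Ico (α.N l x) (α.N (l + 1) x) → ℝ) :
    update g (l + 1) α ν (setBlock (α.selected l x) (α.N l x) (α.N (l + 1) x) x z) =
      reweight (ν x) fun θ => g (α.selected l x) (α.N l x) (α.N (l + 1) x) z
        (θ.restrict (α.selected l x)) := by
  have hl' := Nat.le_of_succ_le hl
  have hs := h.sameInfo_setBlock hl' _ (α.N (l + 1) x) x z
  rw [update_succ, ← h.selected_eq hl' hs, ← h.N_eq hl hs, ← h.N_eq hl' (hs.mono (l.sub_le 1)),
    ← (h.predictableUpTo hl').eq_of_sameInfo hν hs, block_setBlock]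

theorem update_eq (h : S.Admissible α) (hl : l + 1 ≤ S.L) (hν : Measurable[α.filtration l] ν)
    (g : DensityMap S.ns) (hxy : α.SameInfo (l + 1) x y) :
    update g (l + 1) α ν x = update g (l + 1) α ν y := by
  have hl' := Nat.le_of_succ_le hl
  have hs := hxy.mono l.le_succ
  have hblock : block (α.selected l x) (α.N l x) (α.N (l + 1) x) x = block _ _ _ y := by
    funext ⟨i, j⟩
    exact hxy l l.lt_succ_self i i.2 j (Finset.mem_Ico.1 j.2).2
  rw [update_succ, update_succ, ← h.selected_eq hl' hs, ← h.N_eq hl hs,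
    ← h.N_eq hl' (hs.mono (l.sub_le 1)), ← (h.predictableUpTo hl').eq_of_sameInfo hν hs, hblock]

end

section Kernel

variable {ν : Kernel (Path S.ns) (Param (Fin S.ns))} [IsMarkovKernel ν]

theorem measurable_update (h : S.Admissible α) (hl : l + 1 ≤ S.L)
    (hν : Measurable[α.filtration l] ν) (hg : ∀ A N N', Measurable (Function.uncurry (g A N N'))) :
    Measurable[α.filtration (l + 1)] (update g (l + 1) α ν) := by
  have hl' := Nat.le_of_succ_le hl
  refine (h.predictableUpTo hl).measurable_filtration_of_sameInfo ?_ fun x y => h.update_eq hl hν g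
  have hw : ∀ a : Finset (Fin S.ns) × ℕ × ℕ, Measurable (Function.uncurry fun x (θ : Param _) =>
      (g a.1 a.2.1 a.2.2 (block _ _ _ x) (θ.restrict a.1) : ℝ≥0∞)) := fun a =>
    ((measurable_density (hg _ _ _)).comp
      (((measurable_block _ _ _).comp measurable_fst).prodMk measurable_snd)).coe_nnreal_ennreal
  have hglue : Measurable fun p : (Finset (Fin S.ns) × ℕ × ℕ) × Path S.ns =>
      reweight (ν p.2) fun θ => g p.1.1 p.1.2.1 p.1.2.2 (block _ _ _ p.2) (θ.restrict p.1.1) :=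
    measurable_from_prod_countable_right fun a => measurable_reweight ν (hw a)
  exact hglue.comp (((h.measurable_selected hl').prodMk
    ((h.measurable_N hl').prodMk (h.measurable_N hl))).prodMk measurable_id)

theorem measurable_lintegral_update (h : S.Admissible α) (hl : l + 1 ≤ S.L)
    (hν : Measurable[α.filtration l] ν) (hg : ∀ A N N', Measurable (Function.uncurry (g A N N')))
    {Ψ : Param (Fin S.ns) × Path S.ns → ℝ≥0∞} (hΨ : Measurable Ψ) :
    Measurable fun x => ∫⁻ θ, Ψ (θ, x) ∂(update g (l + 1) α ν x) := by
  let κ : Kernel (Path S.ns) (Param (Fin S.ns)) :=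
    ⟨update g (l + 1) α ν, (h.measurable_update hl hν hg).mono (h.filtration_le hl) le_rfl⟩
  have : IsFiniteKernel κ := ⟨1, ENNReal.one_lt_top, fun x => prob_le_one (μ := update _ _ _ _ x)⟩
  exact (hΨ.comp measurable_swap).lintegral_kernel_prod_right' (κ := κ)

variable {past : Measure (Path S.ns)} [SFinite past] {m : BaseMeasure S.ns}
  {Φ Ψ : Param (Fin S.ns) × Path S.ns → ℝ≥0∞}

theorem ae_hasBlockDensity (h : S.Admissible α) (hl : l + 1 ≤ S.L)
    (hν : Measurable[α.filtration l] ν)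
    (hd : ∀ᵐ ω ∂(stepLaw mkt l α ν past), HasBlockDensity mkt m g (α.selected l ω.2)
      (α.N l ω.2) (α.N (l + 1) ω.2) ω.1) :
    ∀ᵐ x ∂(stepLaw mkt l α ν past).snd, ∀ᵐ θ ∂(ν x),
      HasBlockDensity mkt m g (α.selected l x) (α.N l x) (α.N (l + 1) x) θ := by
  have hl' := Nat.le_of_succ_le hl
  filter_upwards [h.ae_of_ae_stepLaw hl' hν hd] with x hx
  filter_upwards [hx] with θ hθ
  obtain ⟨y, hy⟩ := hθ.exists
  have hs := h.sameInfo_splice hl' x y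
  rwa [← h.selected_eq hl' hs, ← h.N_eq hl hs, ← h.N_eq hl' (hs.mono (l.sub_le 1))] at hy

theorem condE_lintegral_update (h : S.Admissible α) (hl : l + 1 ≤ S.L)
    (hν : Measurable[α.filtration l] ν) (hg : ∀ A N N', Measurable (Function.uncurry (g A N N')))
    (hgc : ∀ A N N' θ, Continuous fun z => g A N N' z θ)
    (hd : ∀ᵐ ω ∂(stepLaw mkt l α ν past), HasBlockDensity mkt m g (α.selected l ω.2)
      (α.N l ω.2) (α.N (l + 1) ω.2) ω.1)
    (hΨ : Measurable Ψ) (hΨs : ∀ θ x y, α.SameInfo (l + 1) x y → Ψ (θ, x) = Ψ (θ, y)) :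
    condE mkt l α ν (fun ω => ∫⁻ θ, Ψ (θ, ω.2) ∂(update g (l + 1) α ν ω.2))
      =ᵐ[(stepLaw mkt l α ν past).snd] condE mkt l α ν Ψ := by
  filter_upwards [h.ae_hasBlockDensity hl hν hd] with x hx
  set A := α.selected l x
  set N := α.N l x
  set N' := α.N (l + 1) x
  have hblock := measurable_block A N N'
  have hJ : Measurable (Function.uncurry fun z θ => Ψ (θ, setBlock A N N' x z)) :=
    hΨ.comp (measurable_snd.prodMk ((measurable_setBlock A N N' x).comp measurable_fst))
  have hpost : ∀ x y, α.SameInfo (l + 1) x y → ∫⁻ θ, Ψ (θ, x) ∂(update g (l + 1) α ν x) =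
      ∫⁻ θ, Ψ (θ, y) ∂(update g (l + 1) α ν y) := fun x y hxy => by
    rw [h.update_eq hl hν g hxy]
    exact lintegral_congr fun θ => hΨs θ x y hxy
  have hκ : ∀ᵐ θ ∂(ν x), mkt.iid.map (block A N N') θ =
      (m A N N').withDensity fun z => (g A N N' z (θ.restrict A) : ℝ≥0∞) := by
    filter_upwards [hx] with θ hθ using (Kernel.map_apply _ hblock θ).trans hθ
  calc condE mkt l α ν (fun ω => ∫⁻ θ, Ψ (θ, ω.2) ∂(update g (l + 1) α ν ω.2)) x
      = ∫⁻ θ, ∫⁻ z, ∫⁻ θ', Ψ (θ', setBlock A N N' x z)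
          ∂(reweight (ν x) fun θ' => g A N N' z (θ'.restrict A))
          ∂(mkt.iid.map (block A N N') θ) ∂(ν x) := by
        refine lintegral_congr fun θ =>
          (h.lintegral_iid_splice_eq_lintegral_setBlock hl
            (h.measurable_lintegral_update hl hν hg hΨ) hpost θ x).trans
          (lintegral_congr fun z => ?_)
        rw [h.update_setBlock hl hν g x z]
    _ = ∫⁻ θ, ∫⁻ z, Ψ (θ, setBlock A N N' x z) ∂(mkt.iid.map (block A N N') θ) ∂(ν x) :=
        lintegral_lintegral_reweight (measurable_density (hg A N N')) (fun θ => hgc A N N' _) hκ hJ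
    _ = condE mkt l α ν Ψ x :=
        lintegral_congr fun θ => (h.lintegral_iid_splice_eq_lintegral_setBlock hl
          (hΨ.comp measurable_prodMk_left) (hΨs θ) θ x).symm

theorem isPosterior_update (h : S.Admissible α) (hl : l + 1 ≤ S.L)
    (hν : Measurable[α.filtration l] ν) (hg : ∀ A N N', Measurable (Function.uncurry (g A N N')))
    (hgc : ∀ A N N' θ, Continuous fun z => g A N N' z θ)
    (hd : ∀ᵐ ω ∂(stepLaw mkt l α ν past), HasBlockDensity mkt m g (α.selected l ω.2)
      (α.N l ω.2) (α.N (l + 1) ω.2) ω.1) :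
    IsPosterior (stepLaw mkt l α ν past) α (l + 1) (update g (l + 1) α ν) := by
  classical
  refine ⟨h.measurable_update hl hν hg, fun B hB G hG => ?_⟩
  have hl' := Nat.le_of_succ_le hl
  have hGm : MeasurableSet G := h.filtration_le hl _ hG
  let Ψ : Param (Fin S.ns) × Path S.ns → ℝ≥0∞ := (B ×ˢ G).indicator 1
  have hΨ : Measurable Ψ := measurable_one.indicator (hB.prod hGm)
  have hΨ_apply : ∀ θ x, Ψ (θ, x) = G.indicator (fun _ => B.indicator 1 θ) x := fun θ x => by
    by_cases hx : x ∈ G <;> by_cases hθ : θ ∈ B <;> simp [Ψ, hx, hθ]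
  have hΨs : ∀ θ x y, α.SameInfo (l + 1) x y → Ψ (θ, x) = Ψ (θ, y) := fun θ x y hxy => by
    rw [hΨ_apply, hΨ_apply]
    exact (h.predictableUpTo hl).eq_of_sameInfo (measurable_const.indicator hG) hxy
  have hpost : ∀ x, ∫⁻ θ, Ψ (θ, x) ∂(update g (l + 1) α ν x) =
      G.indicator (fun x => update g (l + 1) α ν x B) x := fun x => by
    simp only [hΨ_apply]
    by_cases hx : x ∈ G <;> simp [hx, lintegral_indicator_one hB]
  have hpostm := h.measurable_lintegral_update hl hν hg hΨ
  calc stepLaw mkt l α ν past (B ×ˢ G)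
      = ∫⁻ ω, Ψ ω ∂(stepLaw mkt l α ν past) := (lintegral_indicator_one (hB.prod hGm)).symm
    _ = ∫⁻ x, condE mkt l α ν Ψ x ∂(stepLaw mkt l α ν past).snd :=
        (h.lintegral_condE hl' hν hΨ).symm
    _ = ∫⁻ x, condE mkt l α ν (fun ω => ∫⁻ θ, Ψ (θ, ω.2) ∂(update g (l + 1) α ν ω.2)) x
          ∂(stepLaw mkt l α ν past).snd :=
        lintegral_congr_ae (h.condE_lintegral_update hl hν hg hgc hd hΨ hΨs).symm
    _ = ∫⁻ ω, ∫⁻ θ, Ψ (θ, ω.2) ∂(update g (l + 1) α ν ω.2) ∂(stepLaw mkt l α ν past) :=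
        h.lintegral_condE hl' hν (hpostm.comp measurable_snd)
    _ = ∫⁻ x in G, update g (l + 1) α ν x B ∂(stepLaw mkt l α ν past).snd := by
        rw [← lintegral_indicator hGm, ← lintegral_congr hpost, Measure.snd,
          lintegral_map hpostm measurable_snd]

theorem condE_resample (h : S.Admissible α) (hl : l + 1 ≤ S.L)
    (η : Path S.ns → Measure (Param (Fin S.ns))) (hΦ : Measurable Φ) (x : Path S.ns) :
    condE mkt l α η (resample mkt (α.N (l + 1)) Φ) x = condE mkt l α η Φ x := by
  refine lintegral_congr fun θ => ?_
  have hx := h.sameInfo_splice (Nat.le_of_succ_le hl) x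
  simp only [resample, ← h.N_eq hl (hx _), splice_splice_of_le (h.N_le l.le_succ hl x)]
  exact lintegral_iid_splice mkt θ _ (hΦ.comp (measurable_prodMk_splice θ _ x))

theorem sameInfo_splice_splice (h : S.Admissible α) (hl : l ≤ S.L) (hxy : α.SameInfo l x y)
    (z : Path S.ns) : α.SameInfo S.L (splice (α.N l x) x z) (splice (α.N l x) y z) := by
  intro k _ i hi j hj
  have hs := h.sameInfo_splice hl x z
  by_cases hjN : j < α.N l x
  · simp only [splice, if_pos hjN]
    rcases Nat.lt_or_ge k l with hkl | hlk
    · refine hxy k hkl i ?_ j ?_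
      · rwa [h.selected_eq (hkl.le.trans hl) (hs.mono hkl.le)]
      · rwa [h.N_eq (Nat.le_trans hkl hl) (hs.mono hkl.le)]
    · cases l with
      | zero => exact absurd (h.N_zero x ▸ hjN) j.not_lt_zero
      | succ l =>
        refine hxy l l.lt_succ_self i ?_ j hjN
        rw [h.selected_eq (Nat.le_of_succ_le hl) (hs.mono l.le_succ)]
        exact α.selected_subset_selected (Nat.le_of_succ_le hlk) _ hi
  · simp only [splice, if_neg hjN]

theorem resample_eq (h : S.Admissible α) (hl : l ≤ S.L)
    (hΦ : ∀ θ x y, α.SameInfo S.L x y → Φ (θ, x) = Φ (θ, y)) (θ : Param (Fin S.ns))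
    (hxy : α.SameInfo l x y) :
    resample mkt (α.N l) Φ (θ, x) = resample mkt (α.N l) Φ (θ, y) := by
  simp only [resample, ← h.N_eq hl (hxy.mono (l.sub_le 1))]
  exact lintegral_congr fun z => hΦ θ _ _ (h.sameInfo_splice_splice hl hxy z)

theorem condE_condE_update (h : S.Admissible α) (hl : l + 1 ≤ S.L)
    (hν : Measurable[α.filtration l] ν) (hg : ∀ A N N', Measurable (Function.uncurry (g A N N')))
    (hgc : ∀ A N N' θ, Continuous fun z => g A N N' z θ)
    (hd : ∀ᵐ ω ∂(stepLaw mkt l α ν past), HasBlockDensity mkt m g (α.selected l ω.2)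
      (α.N l ω.2) (α.N (l + 1) ω.2) ω.1)
    (hΦ : Measurable Φ) (hΦs : ∀ θ x y, α.SameInfo S.L x y → Φ (θ, x) = Φ (θ, y)) :
    condE mkt l α ν (fun ω => condE mkt (l + 1) α (update g (l + 1) α ν) Φ ω.2)
      =ᵐ[(stepLaw mkt l α ν past).snd] condE mkt l α ν Φ :=
  (h.condE_lintegral_update hl hν hg hgc hd (measurable_resample mkt (h.measurable_N hl) hΦ)
    fun θ _ _ => h.resample_eq hl hΦs θ).trans (.of_forall (h.condE_resample hl ν hΦ))

end Kernel

end Setup.Admissible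

end Update

section DynamicProgramming

namespace AgreeUpTo

variable {n : ℕ} {α α' : Control n} {l : ℕ}

theorem stepLaw_eq (h : AgreeUpTo l α α') (mkt : Market n) (ν : Kernel (Path n) (Param (Fin n)))
    (past : Measure (Path n)) : stepLaw mkt l α' ν past = stepLaw mkt l α ν past := by
  rw [stepLaw, stepLaw, (h l le_rfl).2]

theorem condE_eq (h : AgreeUpTo l α α') (mkt : Market n) : condE mkt l α' = condE mkt l α := by
  funext ν Φ x
  rw [condE, condE, (h l le_rfl).2]

theorem update_eq (h : AgreeUpTo (l + 1) α α') (g : DensityMap n)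
    (ν : Path n → Measure (Param (Fin n))) : update g (l + 1) α' ν = update g (l + 1) α ν := by
  funext x
  rw [update_succ, update_succ, (h.mono l.le_succ).selected_eq, (h l l.le_succ).2,
    (h (l + 1) le_rfl).2]

theorem continuations_eq {S : Setup} {α α' : Control S.ns} (h : AgreeUpTo l α α') :
    S.continuations l α' = S.continuations l α := by
  ext β
  exact ⟨fun hβ => ⟨hβ.1, h.trans hβ.2.1, hβ.2.2⟩, fun hβ => ⟨hβ.1, h.symm.trans hβ.2.1, hβ.2.2⟩⟩

theorem value_eq {S : Setup} {α α' : Control S.ns} (h : AgreeUpTo l α α') (mkt : Market S.ns)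
    (P : Measure (Path S.ns)) : S.value mkt P l α' = S.value mkt P l α := by
  funext η
  rw [Setup.value, Setup.value, h.continuations_eq]

end AgreeUpTo

variable {S : Setup} {mkt : Market S.ns} {α : Control S.ns} {k l : ℕ}

theorem Setup.continuations_succ_subset (l : ℕ) (α : Control S.ns) :
    S.continuations (l + 1) α ⊆ S.continuations l α :=
  fun _ hβ => ⟨hβ.1, hβ.2.1.mono l.le_succ, hβ.2.2⟩

theorem Setup.value_le (mkt : Market S.ns) (P : Measure (Path S.ns))
    [IsFiniteMeasure P] {β : Control S.ns} (hβ : β ∈ S.continuations l α)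
    (η : Path S.ns → Measure (Param (Fin S.ns))) :
    S.value mkt P l α η ≤ᵐ[P] condE mkt l β η (S.costToGo l β) :=
  (isEssInfFamily_essInfFamily P _).le _ ⟨β, hβ, rfl⟩

theorem Setup.measurable_value (mkt : Market S.ns) (P : Measure (Path S.ns))
    [IsFiniteMeasure P] (l : ℕ) (α : Control S.ns) (η : Path S.ns → Measure (Param (Fin S.ns))) :
    Measurable (S.value mkt P l α η) :=
  (isEssInfFamily_essInfFamily P _).measurable

namespace Setup.Admissible

theorem mem_continuations (h : S.Admissible α) (hK : ∀ x, S.totalCost α x ≤ S.K) (l : ℕ) :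
    α ∈ S.continuations l α :=
  ⟨h, .refl l α, hK⟩

section

variable {η : Path S.ns → Measure (Param (Fin S.ns))} [∀ x, IsZeroOrProbabilityMeasure (η x)]

theorem measurable_condE_filtration (h : S.Admissible α) (hk : k ≤ S.L)
    (hη : Measurable[α.filtration k] η) {Φ : Param (Fin S.ns) × Path S.ns → ℝ≥0∞}
    (hΦ : Measurable Φ) (hΦs : ∀ θ x y, α.SameInfo S.L x y → Φ (θ, x) = Φ (θ, y)) :
    Measurable[α.filtration k] (condE mkt k α η Φ) := by
  have hP := h.predictableUpTo hk
  have hη' : Measurable η := hη.mono (h.filtration_le hk) le_rfl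
  refine hP.measurable_filtration_of_sameInfo (measurable_condE (h.measurable_N hk) hη' hΦ) ?_
  intro x y hxy
  rw [condE, condE, hP.eq_of_sameInfo hη hxy]
  exact lintegral_congr fun θ => h.resample_eq hk hΦs θ hxy

theorem condE_costToGo_paste (h : S.Admissible α) (hk : k ≤ S.L) (β : ℕ → Control S.ns)
    {τ : Path S.ns → ℕ} (hτ : Measurable[α.filtration k] τ)
    (η : Path S.ns → Measure (Param (Fin S.ns))) (x : Path S.ns) :
    condE mkt k α η (S.costToGo k (paste β τ)) x =
      condE mkt k α η (S.costToGo k (β (τ x))) x := by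
  refine lintegral_congr fun θ => lintegral_congr fun y => ?_
  rw [costToGo_paste, ← (h.predictableUpTo hk).eq_of_sameInfo hτ (h.sameInfo_splice hk x y)]

theorem exists_condE_costToGo_le_value_add (h : S.Admissible α)
    (hne : (S.continuations k α).Nonempty) (hk : k ≤ S.L) (hη : Measurable[α.filtration k] η)
    (P : Measure (Path S.ns)) [IsFiniteMeasure P] {ε : ℝ≥0∞} (hε : ε ≠ 0) :
    ∃ β ∈ S.continuations k α, ∀ᵐ x ∂P,
      condE mkt k α η (S.costToGo k β) x ≤ S.value mkt P k α η x + ε := by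
  let T := {F | ∃ β ∈ S.continuations k α, F = condE mkt k β η (S.costToGo k β)}
  have hTm : ∀ F ∈ T, Measurable[α.filtration k] F := by
    rintro _ ⟨β, hβ, rfl⟩
    have hη' : Measurable[β.filtration k] η := hβ.2.1.filtration_eq ▸ hη
    exact hβ.2.1.filtration_eq ▸ hβ.1.measurable_condE_filtration hk hη'
      (hβ.1.measurable_costToGo k) fun θ _ _ hxy => hβ.1.costToGo_eq k hxy θ
  obtain ⟨r, hr⟩ := (isEssInfFamily_essInfFamily P T).exists_seq
    ⟨_, _, hne.choose_spec, rfl⟩ fun F hF => (hTm F hF).mono (h.filtration_le hk) le_rfl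
  obtain ⟨τ, hτ, hτε⟩ := exists_measurable_le_iInf_add (fun j => hTm _ (r j).2) hε
  choose β hβ hrβ using fun j => (r j).2
  refine ⟨paste β τ, paste_mem_continuations hβ hτ, ?_⟩
  filter_upwards [hr] with x hx
  calc condE mkt k α η (S.costToGo k (paste β τ)) x
      = (r (τ x) : Path S.ns → ℝ≥0∞) x := by
        rw [h.condE_costToGo_paste hk β hτ, hrβ, (hβ (τ x)).2.1.condE_eq]
    _ ≤ (⨅ j, (r j : Path S.ns → ℝ≥0∞) x) + ε := hτε x
    _ = S.value mkt P k α η x + ε := by rw [Setup.value, ← hx, iInf_apply]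

end

variable {ν : Kernel (Path S.ns) (Param (Fin S.ns))} [IsMarkovKernel ν]
  {past : Measure (Path S.ns)} {m : BaseMeasure S.ns} {g : DensityMap S.ns}

theorem condE_costToGo [SFinite past] (h : S.Admissible α) (hl : l + 2 ≤ S.L)
    (hν : Measurable[α.filtration l] ν) (hg : ∀ A N N', Measurable (Function.uncurry (g A N N')))
    (hgc : ∀ A N N' θ, Continuous fun z => g A N N' z θ)
    (hd : ∀ᵐ ω ∂(stepLaw mkt l α ν past), HasBlockDensity mkt m g (α.selected l ω.2)
      (α.N l ω.2) (α.N (l + 1) ω.2) ω.1) :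
    condE mkt l α ν (S.costToGo l α) =ᵐ[(stepLaw mkt l α ν past).snd]
      condE mkt l α ν fun ω =>
        condE mkt (l + 1) α (update g (l + 1) α ν) (S.costToGo (l + 1) α) ω.2 +
          S.stepCost α (l + 1) ω := by
  have hl₁ : l + 1 ≤ S.L := Nat.le_of_succ_le hl
  have hN := h.measurable_N (Nat.le_of_succ_le hl₁)
  have hcost := h.measurable_costToGo (l + 1)
  have hpost := (h.measurable_update hl₁ hν hg).mono (h.filtration_le hl₁) le_rfl
  have htower := h.condE_condE_update hl₁ hν hg hgc hd hcost
    fun θ _ _ hxy => h.costToGo_eq (l + 1) hxy θ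
  filter_upwards [htower] with x hx
  rw [funext (S.costToGo_succ hl α), condE_add hN _ hcost, ← hx, ← condE_add hN]
  exact (measurable_condE (h.measurable_N hl₁) hpost hcost).comp measurable_snd

variable [IsFiniteMeasure past]

theorem condE_value_update_le (h : S.Admissible α) (hK : ∀ x, S.totalCost α x ≤ S.K)
    (hl : l + 2 ≤ S.L) (hν : Measurable[α.filtration l] ν)
    (hg : ∀ A N N', Measurable (Function.uncurry (g A N N')))
    (hgc : ∀ A N N' θ, Continuous fun z => g A N N' z θ)
    (hd : ∀ᵐ ω ∂(stepLaw mkt l α ν past), HasBlockDensity mkt m g (α.selected l ω.2)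
      (α.N l ω.2) (α.N (l + 1) ω.2) ω.1) :
    condE mkt l α ν (fun ω => S.value mkt (stepLaw mkt l α ν past).snd (l + 1) α
        (update g (l + 1) α ν) ω.2 + S.stepCost α (l + 1) ω)
      ≤ᵐ[(stepLaw mkt l α ν past).snd] condE mkt l α ν (S.costToGo l α) := by
  refine Filter.EventuallyLE.trans_eq ?_ (h.condE_costToGo hl hν hg hgc hd).symm
  have hvalue := value_le mkt (stepLaw mkt l α ν past).snd (h.mem_continuations hK (l + 1))
    (update g (l + 1) α ν)
  refine h.condE_mono_ae (Nat.le_of_add_right_le hl) hν ?_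
  filter_upwards [ae_of_ae_map measurable_snd.aemeasurable hvalue] with ω hω
  exact add_le_add_left hω _

theorem value_le_condE_value_update (h : S.Admissible α) (hK : ∀ x, S.totalCost α x ≤ S.K)
    (hl : l + 2 ≤ S.L) (hν : Measurable[α.filtration l] ν)
    (hg : ∀ A N N', Measurable (Function.uncurry (g A N N')))
    (hgc : ∀ A N N' θ, Continuous fun z => g A N N' z θ)
    (hd : ∀ᵐ ω ∂(stepLaw mkt l α ν past), HasBlockDensity mkt m g (α.selected l ω.2)
      (α.N l ω.2) (α.N (l + 1) ω.2) ω.1) :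
    S.value mkt (stepLaw mkt l α ν past).snd l α ν ≤ᵐ[(stepLaw mkt l α ν past).snd]
      condE mkt l α ν fun ω => S.value mkt (stepLaw mkt l α ν past).snd (l + 1) α
        (update g (l + 1) α ν) ω.2 + S.stepCost α (l + 1) ω := by
  set P := (stepLaw mkt l α ν past).snd with hP
  set W := fun ω => S.value mkt P (l + 1) α (update g (l + 1) α ν) ω.2 + S.stepCost α (l + 1) ω
  have hl₁ : l + 1 ≤ S.L := Nat.le_of_succ_le hl
  have hl₀ : l ≤ S.L := Nat.le_of_succ_le hl₁
  have hW : Measurable W :=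
    ((measurable_value mkt P _ α _).comp measurable_snd).add (h.measurable_stepCost hl₁)
  refine ae_le_of_forall_ae_le_add fun ε hε => ?_
  obtain ⟨β, hβ, hβε⟩ := h.exists_condE_costToGo_le_value_add (mkt := mkt)
    ⟨α, h.mem_continuations hK (l + 1)⟩ hl₁ (h.measurable_update hl₁ hν hg) P hε
  have hagree : AgreeUpTo l α β := hβ.2.1.mono l.le_succ
  have hβν : Measurable[β.filtration l] ν := hagree.filtration_eq ▸ hν
  have hβd : ∀ᵐ ω ∂(stepLaw mkt l β ν past), HasBlockDensity mkt m g (β.selected l ω.2)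
      (β.N l ω.2) (β.N (l + 1) ω.2) ω.1 := by
    rwa [hagree.stepLaw_eq, hagree.selected_eq, (hagree l le_rfl).2, (hβ.2.1 (l + 1) le_rfl).2]
  have hsplit := hβ.1.condE_costToGo hl hβν hg hgc hβd
  rw [hagree.stepLaw_eq, ← hP, hagree.condE_eq, hβ.2.1.condE_eq, hβ.2.1.update_eq,
    hβ.2.1.stepCost_eq] at hsplit
  have hmono : condE mkt l α ν (fun ω => condE mkt (l + 1) α (update g (l + 1) α ν)
      (S.costToGo (l + 1) β) ω.2 + S.stepCost α (l + 1) ω) ≤ᵐ[P]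
      condE mkt l α ν fun ω => W ω + ε := by
    refine h.condE_mono_ae hl₀ hν ?_
    filter_upwards [ae_of_ae_map measurable_snd.aemeasurable hβε] with ω hω
    exact (add_le_add_left hω _).trans_eq (add_right_comm _ _ _)
  filter_upwards [value_le mkt P (continuations_succ_subset l α hβ) ν, hsplit, hmono]
    with x hvalue hsplit hmono
  calc S.value mkt P l α ν x
      ≤ condE mkt l α ν (S.costToGo l β) x := hagree.condE_eq mkt ▸ hvalue
    _ ≤ condE mkt l α ν (fun ω => W ω + ε) x := hsplit.trans_le hmono
    _ = condE mkt l α ν W x + ε := by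
      rw [condE_add (h.measurable_N hl₀) ν hW, condE_of_forall_eq (Φ := fun _ => ε) fun _ _ => rfl]

end Setup.Admissible

end DynamicProgramming

theorem proposition4_general (S : Setup) (mkt : Market S.ns)
    (M : Set (Measure (Param (Fin S.ns)))) (α : Control S.ns) (l : ℕ) (hl : l + 2 ≤ S.L)
    (ν : Kernel (Path S.ns) (Param (Fin S.ns))) [IsMarkovKernel ν]
    (hν : Measurable[α.filtration l] ν) (past : Measure (Path S.ns)) [IsFiniteMeasure past]
    (m : BaseMeasure S.ns) (g : DensityMap S.ns)
    (hg : ∀ A N N', Measurable (Function.uncurry (g A N N')))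
    (hgc : ∀ A N N' θ, Continuous fun z => g A N N' z θ)
    (hdensity : ∀ α' ∈ S.continuations l α, ∀ᵐ ω ∂(stepLaw mkt l α ν past),
      HasBlockDensity mkt m g (α'.selected l ω.2) (α'.N l ω.2) (α'.N (l + 1) ω.2) ω.1)
    (hposterior : ∀ α' ∈ S.continuations l α, ∀ η,
      IsPosterior (stepLaw mkt l α ν past) α' (l + 1) η →
        ∀ᵐ x ∂(stepLaw mkt l α ν past).snd, η x ∈ M) :
    let P := (stepLaw mkt l α ν past).snd
    (∀ α' ∈ S.continuations l α, ∀ᵐ x ∂P, update g (l + 1) α' ν x ∈ M) ∧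
    S.value mkt P l α ν =ᵐ[P]
      essInfFamily P {F | ∃ α' ∈ S.continuations l α,
        F = condE mkt l α ν (fun ω =>
          S.value mkt P (l + 1) α' (update g (l + 1) α' ν) ω.2 + S.stepCost α' (l + 1) ω)} := by
  intro P
  have hν' : ∀ α' ∈ S.continuations l α, Measurable[α'.filtration l] ν :=
    fun α' hα' => hα'.2.1.filtration_eq ▸ hν
  have hd : ∀ α' ∈ S.continuations l α, ∀ᵐ ω ∂(stepLaw mkt l α' ν past),
      HasBlockDensity mkt m g (α'.selected l ω.2) (α'.N l ω.2) (α'.N (l + 1) ω.2) ω.1 :=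
    fun α' hα' => (hα'.2.1.stepLaw_eq mkt ν past).symm ▸ hdensity α' hα'
  refine ⟨fun α' hα' => hposterior α' hα' _ ?_, Filter.EventuallyLE.antisymm ?_ ?_⟩
  · rw [← hα'.2.1.stepLaw_eq]
    exact hα'.1.isPosterior_update (Nat.le_of_succ_le hl) (hν' α' hα') hg hgc (hd α' hα')
  · refine (isEssInfFamily_essInfFamily P _).greatest _ (Setup.measurable_value ..) ?_
    rintro _ ⟨α', hα', rfl⟩
    have hle := hα'.1.value_le_condE_value_update hα'.2.2 hl (hν' α' hα') hg hgc (hd α' hα')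
    rwa [hα'.2.1.stepLaw_eq, hα'.2.1.condE_eq, hα'.2.1.value_eq] at hle
  · refine (isEssInfFamily_essInfFamily P _).greatest _
      (isEssInfFamily_essInfFamily P _).measurable ?_
    rintro _ ⟨α', hα', rfl⟩
    have hle := hα'.1.condE_value_update_le hα'.2.2 hl (hν' α' hα') hg hgc (hd α' hα')
    rw [hα'.2.1.stepLaw_eq, hα'.2.1.condE_eq] at hle
    rw [hα'.2.1.condE_eq]
    refine Filter.EventuallyLE.trans ((isEssInfFamily_essInfFamily P _).le _ ?_) hle
    exact ⟨α', hα', rfl⟩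

end AdaptiveES

end

open AdaptiveES in
theorem proposition4 (S : Setup) (mkt : Market S.ns)
    (M : Set (Measure (Param (Fin S.ns)))) (hM : ∀ ν ∈ M, IsProbabilityMeasure ν)
    (α : Control S.ns) (hα : S.Admissible α) (l : ℕ) (hl : l + 2 ≤ S.L)
    (ν : Kernel (Path S.ns) (Param (Fin S.ns))) (hν : Measurable[α.filtration l] ν)
    (hνM : ∀ x, ν x ∈ M)
    (past : Measure (Path S.ns)) [IsProbabilityMeasure past]
    (m : BaseMeasure S.ns) (g : DensityMap S.ns)
    (hA : S.LearningAssumption mkt M m g (stepLaw mkt l α ν past) l α) :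
    let P := (stepLaw mkt l α ν past).snd
    (∀ α' ∈ S.continuations l α, ∀ᵐ x ∂P, update g (l + 1) α' ν x ∈ M) ∧
    S.value mkt P l α ν =ᵐ[P]
      essInfFamily P {F | ∃ α' ∈ S.continuations l α,
        F = condE mkt l α ν (fun ω =>
          S.value mkt P (l + 1) α' (update g (l + 1) α' ν) ω.2 + S.stepCost α' (l + 1) ω)} := by
  have : IsMarkovKernel ν := ⟨fun x => hM _ (hνM x)⟩
  have hl₁ : l + 1 ≤ S.L := Nat.le_of_succ_le hl
  exact proposition4_general S mkt M α l hl ν hν past m g hA.regular.measurable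
    (fun A N N' θ => (hA.regular.continuous A N N').continuous θ)
    (fun α' hα' => hA.density α' hα'.1 hα'.2.1 (l + 1) l.lt_succ_self hl₁)
    (fun α' hα' => hA.posterior_mem α' hα'.1 hα'.2.1 (l + 1) l.le_succ hl₁)
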